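/- Fix an integer $k\ge 1$. Let $\mathbb{H}^k=\mathbb{R}^{2k}\times\mathbb{R}$ be the Heisenberg group with group law $(v,t)\cdot(v',t')=(v+v',\,t+t'+\tfrac12\omega(v,v'))$, where $\omega(v,v')=\sum_{j=1}^k (v_jv'_{j+k}-v_{j+k}v'_j)$, equipped with the Korányi distance $d(p,q)=\|q^{-1}\cdot p\|$, where $\|(v,t)\|=(|v|^4+16t^2)^{1/4}$. Let $B(p,r)$ denote the open balls of $d$ and $\mathcal{H}^{2k+1}$ the $(2k+1)$-dimensional Hausdorff measure of $d$. For $C\ge 1$, a set $E\subset\mathbb{H}^k$ is called $C$-Ahlfors regular if it is closed and $C^{-1}r^{2k+1}\le \mathcal{H}^{2k+1}(E\cap B(p,r))\le C r^{2k+1}$ for all $p\in E$ and $r>0$. For $E\subset\mathbb{H}^k$, $p\in E$ and $s>0$ put $$b\beta_E(p,s)=s^{-1}\inf_{P}\Big\{\sup_{q\in B(p,s)\cap E}\operatorname{dist}(q,P)+\sup_{q\in B(p,s)\cap P}\operatorname{dist}(q,E)\Big\},$$ where $P$ ranges over all affine hyperplanes of $\mathbb{H}^k$ identified with the vector space $\mathbb{R}^{2k+1}$,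 $\operatorname{dist}$ is taken with respect to $d$, and $\sup\emptyset=0$. For $\gamma>0$, a set $A\subset E\times(0,\infty)$ is called $\gamma$-Carleson if it is measurable and $$\int_0^r\int_{E\cap B(p,r)}\chi_A(q,s)\,d\mathcal{H}^{2k+1}(q)\,\frac{ds}{s}\le\gamma r^{2k+1}\qquad\text{for all }p\in E,\ r>0.$$ For $C\ge1$ and $\gamma:(0,1)\to(0,\infty)$, let $\operatorname{BWGL}(C,\gamma)$ be the class of $C$-Ahlfors regular sets $E\subset\mathbb{H}^k$ such that for each $\epsilon\in(0,1)$ the set $\{(p,s)\in E\times(0,\infty): b\beta_E(p,s)>\epsilon\}$ is $\gamma(\epsilon)$-Carleson. **Theorem.** For all $C\ge 1$, $\theta>0$, $C_1\ge 1$ and $\gamma_1:(0,1)\to(0,\infty)$ there is $\gamma:(0,1)\to(0,\infty)$, depending only on $k$, $C$, $\theta$, $C_1$ and $\gamma_1$, with the following property. Let $E\subset\mathbb{H}^k$ be $C$-Ahlfors regular and suppose that for each $p\in E$ and each $r>0$ there is $\widetilde E\in\operatorname{BWGL}(C_1,\gamma_1)$ such that $$\mathcal{H}^{2k+1}(E\cap\widetilde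 E\cap B(p,r))\ge\theta\, r^{2k+1}.$$ Then $E\in\operatorname{BWGL}(C,\gamma)$. -/

import Mathlib

open MeasureTheory Metric
open scoped ENNReal

noncomputable section

/-- The space `ℝ^{2k}` with its Euclidean norm. The coordinate `Sum.inl j` is the `j`-th one and
`Sum.inr j` is the `(j+k)`-th one. -/
abbrev HorizontalSpace (k : ℕ) : Type := EuclideanSpace ℝ (Fin k ⊕ Fin k)

/-- The standard symplectic form on `ℝ^{2k}`. -/
def symplecticForm {k : ℕ} (v w : HorizontalSpace k) : ℝ :=
  ∑ j : Fin k, (v (Sum.inl j) * w (Sum.inr j) - v (Sum.inr j) * w (Sum.inl j))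

/-- The underlying set `ℝ^{2k} × ℝ` of the Heisenberg group `ℍ^k`. It is a structure so that it
carries the Korányi distance and not the product distance. -/
@[ext]
structure Heisenberg (k : ℕ) : Type where
  v : HorizontalSpace k
  t : ℝ

namespace Heisenberg

variable {k : ℕ}

instance : Mul (Heisenberg k) :=
  ⟨fun p q => ⟨p.v + q.v, p.t + q.t + symplecticForm p.v q.v / 2⟩⟩

instance : One (Heisenberg k) := ⟨⟨0, 0⟩⟩

instance : Inv (Heisenberg k) := ⟨fun p => ⟨-p.v, -p.t⟩⟩

@[simp] lemma mul_v (p q : Heisenberg k) : (p * q).v = p.v + q.v := rfl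

@[simp] lemma mul_t (p q : Heisenberg k) :
    (p * q).t = p.t + q.t + symplecticForm p.v q.v / 2 := rfl

@[simp] lemma one_v : (1 : Heisenberg k).v = 0 := rfl

@[simp] lemma one_t : (1 : Heisenberg k).t = 0 := rfl

@[simp] lemma inv_v (p : Heisenberg k) : (p⁻¹).v = -p.v := rfl

@[simp] lemma inv_t (p : Heisenberg k) : (p⁻¹).t = -p.t := rfl

lemma symplecticForm_add_left (u v w : HorizontalSpace k) :
    symplecticForm (u + v) w = symplecticForm u w + symplecticForm v w := by
  simp only [symplecticForm, ← Finset.sum_add_distrib]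
  refine Finset.sum_congr rfl fun j _ => ?_
  simp only [PiLp.add_apply]
  ring

lemma symplecticForm_add_right (u v w : HorizontalSpace k) :
    symplecticForm u (v + w) = symplecticForm u v + symplecticForm u w := by
  simp only [symplecticForm, ← Finset.sum_add_distrib]
  refine Finset.sum_congr rfl fun j _ => ?_
  simp only [PiLp.add_apply]
  ring

lemma symplecticForm_neg_left (v w : HorizontalSpace k) :
    symplecticForm (-v) w = -symplecticForm v w := by
  simp only [symplecticForm, ← Finset.sum_neg_distrib]
  refine Finset.sum_congr rfl fun j _ => ?_
  simp only [PiLp.neg_apply]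
  ring

lemma symplecticForm_self (v : HorizontalSpace k) : symplecticForm v v = 0 := by
  simp only [symplecticForm]
  refine Finset.sum_eq_zero fun j _ => ?_
  ring

lemma symplecticForm_zero_left (v : HorizontalSpace k) : symplecticForm 0 v = 0 := by
  simp [symplecticForm]

lemma symplecticForm_zero_right (v : HorizontalSpace k) : symplecticForm v 0 = 0 := by
  simp [symplecticForm]

instance : Group (Heisenberg k) :=
  Group.ofLeftAxioms
    (fun p q r => by
      ext1
      · simp [add_assoc]
      · simp only [mul_t, mul_v, symplecticForm_add_left, symplecticForm_add_right]
        ring)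
    (fun p => by
      ext1
      · simp
      · simp [symplecticForm_zero_left])
    (fun p => by
      ext1
      · simp
      · simp [symplecticForm_neg_left, symplecticForm_self])

/-- The Korányi norm `‖(v,t)‖ = (|v|⁴ + 16 t²)^{1/4}`. -/
def koranyiNorm (p : Heisenberg k) : ℝ := (‖p.v‖ ^ 4 + 16 * p.t ^ 2) ^ (1 / 4 : ℝ)

lemma koranyiNorm_nonneg (p : Heisenberg k) : 0 ≤ koranyiNorm p := by
  unfold koranyiNorm
  positivity

lemma koranyiNorm_pow_four (p : Heisenberg k) :
    koranyiNorm p ^ 4 = ‖p.v‖ ^ 4 + 16 * p.t ^ 2 := by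
  unfold koranyiNorm
  rw [← Real.rpow_natCast, ← Real.rpow_mul (by positivity)]
  norm_num

lemma norm_v_le_koranyiNorm (p : Heisenberg k) : ‖p.v‖ ≤ koranyiNorm p := by
  refine le_of_pow_le_pow_left₀ (n := 4) (by norm_num) (koranyiNorm_nonneg p) ?_
  rw [koranyiNorm_pow_four]
  nlinarith [sq_nonneg p.t]

lemma koranyiNorm_inv (p : Heisenberg k) : koranyiNorm p⁻¹ = koranyiNorm p := by
  simp [koranyiNorm]

lemma inner_sq_add_symplecticForm_sq_le (v w : HorizontalSpace k) :
    (inner ℝ v w) ^ 2 + (symplecticForm v w) ^ 2 ≤ (‖v‖ * ‖w‖) ^ 2 := by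
  let c : HorizontalSpace k → EuclideanSpace ℂ (Fin k) := fun u =>
    WithLp.toLp 2 fun j => (⟨u (Sum.inl j), u (Sum.inr j)⟩ : ℂ)
  have hnorm : ∀ u : HorizontalSpace k, ‖c u‖ = ‖u‖ := fun u => by
    rw [EuclideanSpace.norm_eq, EuclideanSpace.norm_eq, Fintype.sum_sum_type,
      ← Finset.sum_add_distrib]
    congr 1
    refine Finset.sum_congr rfl fun j _ => ?_
    rw [← Complex.normSq_eq_norm_sq, Complex.normSq_apply]
    simp only [c, Real.norm_eq_abs, sq_abs]
    ring
  have hre : (inner ℂ (c v) (c w)).re = inner ℝ v w := by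
    rw [PiLp.inner_apply, PiLp.inner_apply, Complex.re_sum, Fintype.sum_sum_type,
      ← Finset.sum_add_distrib]
    refine Finset.sum_congr rfl fun j _ => ?_
    simp [c]
  have him : (inner ℂ (c v) (c w)).im = symplecticForm v w := by
    rw [PiLp.inner_apply, Complex.im_sum, symplecticForm]
    refine Finset.sum_congr rfl fun j _ => ?_
    simp [c]
    ring
  have h := norm_inner_le_norm (𝕜 := ℂ) (c v) (c w)
  have h2 := pow_le_pow_left₀ (norm_nonneg _) h 2
  rw [← Complex.normSq_eq_norm_sq, Complex.normSq_apply, hre, him, hnorm, hnorm] at h2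
  linarith

lemma koranyiNorm_mul_le (p q : Heisenberg k) :
    koranyiNorm (p * q) ≤ koranyiNorm p + koranyiNorm q := by
  have hsq : ∀ r : Heisenberg k,
      ‖(⟨‖r.v‖ ^ 2, 4 * r.t⟩ : ℂ)‖ = koranyiNorm r ^ 2 := fun r => by
    have : ‖(⟨‖r.v‖ ^ 2, 4 * r.t⟩ : ℂ)‖ ^ 2 = (koranyiNorm r ^ 2) ^ 2 := by
      rw [← Complex.normSq_eq_norm_sq, Complex.normSq_apply, ← pow_mul, koranyiNorm_pow_four]
      ring
    exact (pow_left_inj₀ (norm_nonneg _) (sq_nonneg _) two_ne_zero).1 this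
  have hcs : ‖(⟨inner ℝ p.v q.v, symplecticForm p.v q.v⟩ : ℂ)‖ ≤ ‖p.v‖ * ‖q.v‖ := by
    refine le_of_pow_le_pow_left₀ two_ne_zero (by positivity) ?_
    rw [← Complex.normSq_eq_norm_sq, Complex.normSq_apply]
    linarith [inner_sq_add_symplecticForm_sq_le p.v q.v]
  have hdec : (⟨‖(p * q).v‖ ^ 2, 4 * (p * q).t⟩ : ℂ) =
      ⟨‖p.v‖ ^ 2, 4 * p.t⟩ + ⟨‖q.v‖ ^ 2, 4 * q.t⟩
        + 2 * ⟨inner ℝ p.v q.v, symplecticForm p.v q.v⟩ := by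
    apply Complex.ext
    · simp [norm_add_sq_real]
      ring
    · simp
      ring
  have h2 : ‖(2 : ℂ)‖ = 2 := by simp
  have hle : koranyiNorm (p * q) ^ 2 ≤ (koranyiNorm p + koranyiNorm q) ^ 2 := by
    rw [← hsq, hdec]
    refine (norm_add₃_le).trans ?_
    rw [norm_mul, hsq, hsq, h2]
    have hpq : ‖p.v‖ * ‖q.v‖ ≤ koranyiNorm p * koranyiNorm q :=
      mul_le_mul (norm_v_le_koranyiNorm p) (norm_v_le_koranyiNorm q) (norm_nonneg _)
        (koranyiNorm_nonneg p)
    nlinarith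
  exact le_of_pow_le_pow_left₀ two_ne_zero
    (add_nonneg (koranyiNorm_nonneg p) (koranyiNorm_nonneg q)) hle

lemma eq_one_of_koranyiNorm_eq_zero {p : Heisenberg k} (h : koranyiNorm p = 0) : p = 1 := by
  have h4 := koranyiNorm_pow_four p
  rw [h] at h4
  have hv : ‖p.v‖ ^ 4 = 0 := by nlinarith [pow_nonneg (norm_nonneg p.v) 4, sq_nonneg p.t]
  have ht : p.t ^ 2 = 0 := by nlinarith [pow_nonneg (norm_nonneg p.v) 4, sq_nonneg p.t]
  ext1
  · simpa using hv
  · simpa using ht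

/-- The Korányi distance `d(p,q) = ‖q⁻¹ · p‖`. -/
instance : MetricSpace (Heisenberg k) where
  dist p q := koranyiNorm (q⁻¹ * p)
  dist_self p := by
    simp [koranyiNorm]
  dist_comm p q := by
    rw [← koranyiNorm_inv]
    simp only [mul_inv_rev, inv_inv]
  dist_triangle p q r := by
    have h : r⁻¹ * p = (r⁻¹ * q) * (q⁻¹ * p) := by group
    rw [h, add_comm]
    exact koranyiNorm_mul_le _ _
  eq_of_dist_eq_zero {p q} h :=
    (inv_mul_eq_one.1 (eq_one_of_koranyiNorm_eq_zero h)).symm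

lemma dist_def (p q : Heisenberg k) : dist p q = koranyiNorm (q⁻¹ * p) := rfl

instance : MeasurableSpace (Heisenberg k) := borel _

instance : BorelSpace (Heisenberg k) := ⟨rfl⟩

/-- The `(2k+1)`-dimensional Hausdorff measure of the Korányi distance. -/
def surfaceMeasure (k : ℕ) : Measure (Heisenberg k) := Measure.hausdorffMeasure (2 * k + 1 : ℝ)

/-- `E` is `C`-Ahlfors regular (with dimension `2k+1`). -/
def IsAhlforsRegular (C : ℝ) (E : Set (Heisenberg k)) : Prop :=
  IsClosed E ∧ ∀ p ∈ E, ∀ r : ℝ, 0 < r →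
    ENNReal.ofReal (C⁻¹ * r ^ (2 * k + 1)) ≤ surfaceMeasure k (E ∩ ball p r) ∧
      surfaceMeasure k (E ∩ ball p r) ≤ ENNReal.ofReal (C * r ^ (2 * k + 1))

/-- `A` is a `γ`-Carleson subset of `E × (0,∞)`. -/
def IsCarleson (E : Set (Heisenberg k)) (γ : ℝ) (A : Set (Heisenberg k × ℝ)) : Prop :=
  A ⊆ E ×ˢ Set.Ioi (0 : ℝ) ∧ MeasurableSet A ∧ ∀ p ∈ E, ∀ r : ℝ, 0 < r →
    ∫⁻ s in Set.Ioo 0 r,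
        (∫⁻ q in E ∩ ball p r, A.indicator (fun _ => (1 : ℝ≥0∞)) (q, s) ∂surfaceMeasure k)
          / ENNReal.ofReal s
      ≤ ENNReal.ofReal (γ * r ^ (2 * k + 1))

/-- `P` is an affine hyperplane of `ℍ^k` identified with the vector space `ℝ^{2k} × ℝ`. -/
def IsAffineHyperplane (P : Set (Heisenberg k)) : Prop :=
  ∃ (a : HorizontalSpace k) (b c : ℝ), (a ≠ 0 ∨ b ≠ 0) ∧ P = {p | inner ℝ a p.v + b * p.t = c}

/-- The bilateral `β`-number `bβ_E(p,s)`, as an extended nonnegative real number (the supremum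
over the empty set is `0`). -/
def bilateralBeta (E : Set (Heisenberg k)) (p : Heisenberg k) (s : ℝ) : ℝ≥0∞ :=
  (⨅ (P : Set (Heisenberg k)) (_ : IsAffineHyperplane P),
    ((⨆ q ∈ ball p s ∩ E, infEDist q P) + ⨆ q ∈ ball p s ∩ P, infEDist q E))
    / ENNReal.ofReal s

/-- The class `BWGL(C,γ)` of subsets of `ℍ^k`. -/
def BWGL (k : ℕ) (C : ℝ) (γ : Set.Ioo (0 : ℝ) 1 → Set.Ioi (0 : ℝ)) : Set (Set (Heisenberg k)) :=
  {E | IsAhlforsRegular C E ∧ ∀ ε : Set.Ioo (0 : ℝ) 1,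
    IsCarleson E (γ ε)
      {x | x.1 ∈ E ∧ 0 < x.2 ∧ ENNReal.ofReal (ε : ℝ) < bilateralBeta E x.1 x.2}}

end Heisenberg

end

noncomputable section

namespace Heisenberg

open Filter Topology

variable {k : ℕ}

/-! ### Topology of the Heisenberg group -/

/-! Up to measurability, the Carleson integral over a ball is at most the integral of a counting
function: the number of dyadic scales at which E fails to be flat at a point
(`lintegral_le_tsum_measure`). It is bounded in two stages.

Inside a big piece F of E ∩ E' the count has controlled integral. If E is not flat at (y,s), then at
(y,2s) either E' is not flat, or one of E, E' has a point far from the other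
(`flatness_comparison`). The first case is paid for by the Carleson condition on E'
(`sum_measure_le_of_isCarleson`). In the second, say z in E lies near y in F but farther than εs
from E'; a ball of E around z then has measure about s^(2k+1) and lies at distance comparable to s
from E'. A given point of E serves only boundedly many scales in this way (`sum_measure_far_le`).
The other case is symmetric.

By Chebyshev, every ball centred on E thus has a fixed proportion on which the count, from the scale
of the ball down, is at most K (`le_measure_good`). A John–Nirenberg type stopping argument turns
this into an integral bound. Indicators are replaced by Lipschitz bumps, so that the sum over scales
coarser than a ball is almost constant on it. A Vitali covering then bounds each superlevel set of
the sum by its complement in a lower one (`measure_levelSet_le`), and these differences are disjoint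
(`lintegral_sum_le_of_good_sets`).

Measurability of the bad set comes from compactness of the family of nearly optimal hyperplanes
(`flatness_le_of_forall_lt`). -/

lemma dist_pow_four (p q : Heisenberg k) :
    dist p q ^ 4 = ‖p.v - q.v‖ ^ 4 + 16 * (p.t - q.t - symplecticForm q.v p.v / 2) ^ 2 := by
  rw [dist_def, koranyiNorm_pow_four]
  simp only [mul_v, inv_v, mul_t, inv_t, symplecticForm_neg_left]
  rw [neg_add_eq_sub]
  ring

lemma norm_v_sub_le_dist (p q : Heisenberg k) : ‖p.v - q.v‖ ≤ dist p q := by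
  have := norm_v_le_koranyiNorm (q⁻¹ * p)
  rwa [mul_v, inv_v, neg_add_eq_sub] at this

lemma abs_t_sub_le_dist_sq (p q : Heisenberg k) :
    |p.t - q.t - symplecticForm q.v p.v / 2| ≤ dist p q ^ 2 := by
  refine abs_le_of_sq_le_sq ?_ (sq_nonneg _)
  have := dist_pow_four p q
  nlinarith [pow_nonneg (norm_nonneg (p.v - q.v)) 4,
    sq_nonneg (p.t - q.t - symplecticForm q.v p.v / 2)]

lemma continuous_v : Continuous (fun p : Heisenberg k => p.v) := by
  refine (LipschitzWith.of_dist_le_mul (K := 1) fun p q => ?_).continuous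
  simpa [dist_eq_norm] using norm_v_sub_le_dist p q

lemma continuous_symplecticForm :
    Continuous (fun x : HorizontalSpace k × HorizontalSpace k => symplecticForm x.1 x.2) := by
  unfold symplecticForm
  fun_prop

/-- The distance controls the difference of heights only up to a symplectic term, which is
continuous and vanishes at the base point. -/
lemma continuous_t : Continuous (fun p : Heisenberg k => p.t) := by
  refine continuous_iff_continuousAt.2 fun q => ?_
  have h1 : Tendsto (fun p : Heisenberg k => p.t - q.t - symplecticForm q.v p.v / 2)
      (𝓝 q) (𝓝 0) := by
    refine squeeze_zero_norm (fun p => abs_t_sub_le_dist_sq p q) ?_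
    have : Tendsto (fun p : Heisenberg k => dist p q ^ 2) (𝓝 q) (𝓝 (dist q q ^ 2)) :=
      Continuous.tendsto (by fun_prop) q
    simpa using this
  have h2 : Tendsto (fun p : Heisenberg k => q.t + symplecticForm q.v p.v / 2)
      (𝓝 q) (𝓝 (q.t + symplecticForm q.v q.v / 2)) :=
    Continuous.tendsto (continuous_const.add
      ((continuous_symplecticForm.comp (continuous_const.prodMk continuous_v)).div_const 2)) q
  have h3 := h1.add h2
  rw [symplecticForm_self] at h3
  simp only [zero_div, add_zero, zero_add] at h3
  refine h3.congr fun p => ?_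
  ring

lemma continuous_mk {Z : Type*} [TopologicalSpace Z] {f : Z → HorizontalSpace k} {g : Z → ℝ}
    (hf : Continuous f) (hg : Continuous g) :
    Continuous (fun z => (⟨f z, g z⟩ : Heisenberg k)) := by
  refine continuous_iff_continuousAt.2 fun z => ?_
  rw [ContinuousAt, tendsto_iff_dist_tendsto_zero]
  have h4 : Tendsto (fun x => dist (⟨f x, g x⟩ : Heisenberg k) ⟨f z, g z⟩ ^ 4) (𝓝 z) (𝓝 0) := by
    simp only [dist_pow_four]
    have hc : Continuous fun x => ‖f x - f z‖ ^ 4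
        + 16 * (g x - g z - symplecticForm (f z) (f x) / 2) ^ 2 := by
      have := continuous_symplecticForm.comp ((continuous_const (y := f z)).prodMk hf)
      simp only [Function.comp_def] at this
      fun_prop
    have := hc.tendsto z
    simpa [symplecticForm_self] using this
  have h5 := h4.rpow_const (p := 1 / 4) (Or.inr (by norm_num))
  rw [Real.zero_rpow (by norm_num)] at h5
  refine h5.congr fun x => ?_
  rw [← Real.rpow_natCast, ← Real.rpow_mul dist_nonneg]
  norm_num

lemma abs_symplecticForm_le (v w : HorizontalSpace k) : |symplecticForm v w| ≤ ‖v‖ * ‖w‖ := by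
  refine abs_le_of_sq_le_sq ?_ (by positivity)
  nlinarith [inner_sq_add_symplecticForm_sq_le v w, sq_nonneg (inner ℝ v w)]

/-- Korányi balls are bounded in Euclidean coordinates. This gives attained distances and the
compactness arguments for hyperplanes. -/
instance : ProperSpace (Heisenberg k) := by
  refine ⟨fun q r => ?_⟩
  set M := ‖q.v‖ + r
  set M' := r ^ 2 + |q.t| + ‖q.v‖ * M
  have hK : IsCompact ((fun x : HorizontalSpace k × ℝ => (⟨x.1, x.2⟩ : Heisenberg k)) ''
      (closedBall 0 M ×ˢ closedBall 0 M')) :=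
    ((isCompact_closedBall _ _).prod (isCompact_closedBall _ _)).image
      (continuous_mk continuous_fst continuous_snd)
  refine hK.of_isClosed_subset isClosed_closedBall fun p hp => ?_
  rw [mem_closedBall] at hp
  have hv : ‖p.v‖ ≤ M := by
    have h1 := norm_v_sub_le_dist p q
    have h2 := norm_add_le q.v (p.v - q.v)
    rw [add_sub_cancel] at h2
    linarith
  refine ⟨(p.v, p.t), ⟨by simpa using hv, ?_⟩, rfl⟩
  have h1 := abs_le.1 (abs_t_sub_le_dist_sq p q)
  have h2 : dist p q ^ 2 ≤ r ^ 2 := pow_le_pow_left₀ dist_nonneg hp 2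
  have h3 := abs_le.1 (abs_symplecticForm_le q.v p.v)
  have h4 : ‖q.v‖ * ‖p.v‖ ≤ ‖q.v‖ * M := by gcongr
  have h5 := abs_le.1 (le_refl |q.t|)
  have h6 : 0 ≤ ‖q.v‖ * ‖p.v‖ := by positivity
  simp only [mem_closedBall, dist_zero_right, Real.norm_eq_abs]
  exact abs_le.2 ⟨by simp only [M']; linarith, by simp only [M']; linarith⟩

/-! ### Lower semicontinuity of the flatness and measurability -/

/-- The hyperplane with coefficients `y`. -/
def hyperplane (y : HorizontalSpace k × ℝ × ℝ) : Set (Heisenberg k) :=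
  {p | inner ℝ y.1 p.v + y.2.1 * p.t = y.2.2}

/-- Coefficients of hyperplanes with a unit normal vector. -/
def unitCoeffs (k : ℕ) : Set (HorizontalSpace k × ℝ × ℝ) :=
  {y | ‖y.1‖ ^ 2 + y.2.1 ^ 2 = 1}

lemma isAffineHyperplane_hyperplane {y : HorizontalSpace k × ℝ × ℝ} (hy : y ∈ unitCoeffs k) :
    IsAffineHyperplane (hyperplane y) := by
  refine ⟨y.1, y.2.1, y.2.2, ?_, rfl⟩
  by_contra! h
  have hy' : ‖y.1‖ ^ 2 + y.2.1 ^ 2 = 1 := hy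
  simp [h.1, h.2] at hy'

lemma IsAffineHyperplane.exists_unitCoeffs {P : Set (Heisenberg k)} (hP : IsAffineHyperplane P) :
    ∃ y ∈ unitCoeffs k, P = hyperplane y := by
  obtain ⟨a, b, c, hab, rfl⟩ := hP
  have hpos : 0 < ‖a‖ ^ 2 + b ^ 2 := by
    rcases hab with h | h
    · have := norm_pos_iff.2 h
      positivity
    · positivity
  set l := Real.sqrt (‖a‖ ^ 2 + b ^ 2)
  have hl : 0 < l := Real.sqrt_pos.2 hpos
  have hl2 : l ^ 2 = ‖a‖ ^ 2 + b ^ 2 := Real.sq_sqrt hpos.le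
  refine ⟨(l⁻¹ • a, l⁻¹ * b, l⁻¹ * c), ?_, ?_⟩
  · simp only [unitCoeffs, Set.mem_ofPred_eq, norm_smul, norm_inv, Real.norm_eq_abs, abs_of_pos hl]
    field_simp
    exact hl2.symm
  · ext p
    simp only [hyperplane, Set.mem_ofPred_eq, real_inner_smul_left]
    rw [mul_assoc, ← mul_add]
    exact (mul_right_inj' (inv_ne_zero hl.ne')).symm

/-- Projection to the hyperplane with coefficients `y`, along its normal vector. -/
def projHyperplane (q : Heisenberg k) (y : HorizontalSpace k × ℝ × ℝ) : Heisenberg k :=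
  ⟨q.v + (y.2.2 - inner ℝ y.1 q.v - y.2.1 * q.t) • y.1,
    q.t + (y.2.2 - inner ℝ y.1 q.v - y.2.1 * q.t) * y.2.1⟩

lemma continuous_projHyperplane (q : Heisenberg k) : Continuous (projHyperplane q) :=
  continuous_mk (by fun_prop) (by fun_prop)

lemma projHyperplane_mem (q : Heisenberg k) {y : HorizontalSpace k × ℝ × ℝ}
    (hy : y ∈ unitCoeffs k) : projHyperplane q y ∈ hyperplane y := by
  have hy' : ‖y.1‖ ^ 2 + y.2.1 ^ 2 = 1 := hy
  simp only [hyperplane, projHyperplane, Set.mem_ofPred_eq, inner_add_right, real_inner_smul_right,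
    real_inner_self_eq_norm_sq]
  linear_combination (y.2.2 - inner ℝ y.1 q.v - y.2.1 * q.t) * hy'

lemma projHyperplane_of_mem {q : Heisenberg k} {y : HorizontalSpace k × ℝ × ℝ}
    (hq : q ∈ hyperplane y) : projHyperplane q y = q := by
  have hq' : inner ℝ y.1 q.v + y.2.1 * q.t = y.2.2 := hq
  have h0 : y.2.2 - inner ℝ y.1 q.v - y.2.1 * q.t = 0 := by linarith
  simp [projHyperplane, h0]

lemma isClosed_mem_hyperplane :
    IsClosed {x : Heisenberg k × (HorizontalSpace k × ℝ × ℝ) | x.1 ∈ hyperplane x.2} := by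
  have hv := (continuous_v (k := k)).comp
    (continuous_fst (X := Heisenberg k) (Y := HorizontalSpace k × ℝ × ℝ))
  have ht := (continuous_t (k := k)).comp
    (continuous_fst (X := Heisenberg k) (Y := HorizontalSpace k × ℝ × ℝ))
  simp only [Function.comp_def] at hv ht
  exact isClosed_eq (by fun_prop) (by fun_prop)

lemma infEDist_hyperplane_le_iff (q : Heisenberg k) {y : HorizontalSpace k × ℝ × ℝ}
    (hy : y ∈ unitCoeffs k) {c : ℝ≥0∞} (hc : c ≠ ⊤) :
    infEDist q (hyperplane y) ≤ c ↔ ∃ x ∈ closedBall q c.toReal, x ∈ hyperplane y := by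
  have hcl : IsClosed (hyperplane y) :=
    isClosed_mem_hyperplane.preimage (Continuous.prodMk_left y)
  constructor
  · intro h
    obtain ⟨x, hx, hxd⟩ := hcl.exists_infDist_eq_dist ⟨_, projHyperplane_mem q hy⟩ q
    refine ⟨x, ?_, hx⟩
    rw [mem_closedBall, dist_comm, ← hxd]
    exact ENNReal.toReal_mono hc h
  · rintro ⟨x, hx, hxy⟩
    refine (infEDist_le_edist_of_mem hxy).trans ?_
    rw [edist_dist, dist_comm]
    exact ENNReal.ofReal_le_of_le_toReal hx

/-- A sublevel set is the projection, along a compact ball around q, of the closed incidence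
relation. -/
lemma lowerSemicontinuous_infEDist_hyperplane (q : Heisenberg k) :
    LowerSemicontinuous fun y : unitCoeffs k => infEDist q (hyperplane y.1) := by
  refine lowerSemicontinuous_iff_isClosed_preimage.2 fun c => ?_
  rcases eq_or_ne c ⊤ with rfl | hc
  · simp
  have : CompactSpace (closedBall q c.toReal) :=
    isCompact_iff_compactSpace.1 (isCompact_closedBall _ _)
  have hcl : IsClosed {x : closedBall q c.toReal × unitCoeffs k | x.1.1 ∈ hyperplane x.2.1} :=
    isClosed_mem_hyperplane.preimage
      (f := fun x : closedBall q c.toReal × unitCoeffs k => (x.1.1, x.2.1)) (by fun_prop)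
  convert isClosedMap_snd_of_compactSpace _ hcl using 1
  ext y
  simp only [Set.mem_preimage, Set.mem_Iic, Set.mem_image, Set.mem_ofPred_eq]
  rw [infEDist_hyperplane_le_iff q y.2 hc]
  constructor
  · rintro ⟨x, hx, hxy⟩
    exact ⟨(⟨x, hx⟩, y), hxy, rfl⟩
  · rintro ⟨⟨x, y'⟩, hxy, rfl⟩
    exact ⟨x, x.2, hxy⟩

/-- The distance on the scale `B(p,s)` between `E` and `P`. -/
def deviation (E P : Set (Heisenberg k)) (p : Heisenberg k) (s : ℝ) : ℝ≥0∞ :=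
  (⨆ q ∈ ball p s ∩ E, infEDist q P) + ⨆ q ∈ ball p s ∩ P, infEDist q E

/-- The unnormalized bilateral `β`-number. -/
def flatness (E : Set (Heisenberg k)) (p : Heisenberg k) (s : ℝ) : ℝ≥0∞ :=
  ⨅ (P : Set (Heisenberg k)) (_ : IsAffineHyperplane P), deviation E P p s

lemma lt_bilateralBeta_iff {E : Set (Heisenberg k)} {p : Heisenberg k} {s ε : ℝ} (hs : 0 < s)
    (hε : 0 ≤ ε) :
    ENNReal.ofReal ε < bilateralBeta E p s ↔ ENNReal.ofReal (ε * s) < flatness E p s := by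
  rw [ENNReal.ofReal_mul hε]
  exact ENNReal.lt_div_iff_mul_lt (Or.inl (by simpa using hs)) (Or.inl ENNReal.ofReal_ne_top)

lemma deviation_mono (E P : Set (Heisenberg k)) {p p' : Heisenberg k} {s s' : ℝ}
    (h : ball p s ⊆ ball p' s') : deviation E P p s ≤ deviation E P p' s' :=
  add_le_add (biSup_mono fun _ hq => ⟨h hq.1, hq.2⟩) (biSup_mono fun _ hq => ⟨h hq.1, hq.2⟩)

lemma flatness_mono (E : Set (Heisenberg k)) {p p' : Heisenberg k} {s s' : ℝ}
    (h : dist p p' ≤ s' - s) : flatness E p s ≤ flatness E p' s' :=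
  iInf₂_mono fun P _ => deviation_mono E P (ball_subset h)

/-- In the second supremum the index set moves with the hyperplane. Projecting along the normal
carries a point of one hyperplane continuously to nearby hyperplanes, so a point far from E
persists. -/
lemma lowerSemicontinuous_deviation (E : Set (Heisenberg k)) (p : Heisenberg k) (s : ℝ) :
    LowerSemicontinuous fun y : unitCoeffs k => deviation E (hyperplane y.1) p s := by
  refine LowerSemicontinuous.add ?_ ?_
  · exact lowerSemicontinuous_iSup fun q => lowerSemicontinuous_iSup fun _ =>
      lowerSemicontinuous_infEDist_hyperplane q
  · intro y c hc
    simp only [lt_iSup_iff] at hc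
    obtain ⟨q, hq, hqc⟩ := hc
    have hcont : Continuous fun y : unitCoeffs k => projHyperplane q y.1 :=
      (continuous_projHyperplane q).comp continuous_subtype_val
    have hopen : IsOpen (ball p s ∩ {x | c < infEDist x E}) :=
      isOpen_ball.inter (isOpen_lt continuous_const continuous_infEDist)
    have hmem : projHyperplane q y.1 ∈ ball p s ∩ {x | c < infEDist x E} := by
      rw [projHyperplane_of_mem hq.2]
      exact ⟨hq.1, hqc⟩
    filter_upwards [hcont.continuousAt.eventually_mem (hopen.mem_nhds hmem)] with z hz
    exact lt_of_lt_of_le hz.2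
      (le_biSup (f := fun x => infEDist x E) ⟨hz.1, projHyperplane_mem q z.2⟩)

/-- Since p itself lies in E, the hyperplane must pass within c of p. With a unit normal this bounds
the constant term. -/
lemma isCompact_deviation_le {E : Set (Heisenberg k)} {p : Heisenberg k} (hp : p ∈ E) {s : ℝ}
    (hs : 0 < s) {c : ℝ≥0∞} (hc : c ≠ ⊤) :
    IsCompact {y : unitCoeffs k | deviation E (hyperplane y.1) p s ≤ c} := by
  rw [Subtype.isCompact_iff]
  obtain ⟨M, hM⟩ := (isCompact_closedBall p c.toReal).exists_bound_of_continuousOn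
    (f := fun x : Heisenberg k => ((x.v, x.t) : HorizontalSpace k × ℝ))
    (continuous_v.prodMk continuous_t).continuousOn
  have hunit : IsClosed (unitCoeffs k) := isClosed_eq (by fun_prop) (by fun_prop)
  have hclosed := ((lowerSemicontinuous_deviation E p s).isClosed_preimage c)
  refine IsCompact.of_isClosed_subset
    (s := closedBall 0 1 ×ˢ closedBall 0 1 ×ˢ closedBall 0 (2 * M)) ?_
    (hunit.isClosedMap_subtype_val _ hclosed) ?_
  · exact (isCompact_closedBall _ _).prod ((isCompact_closedBall _ _).prod
      (isCompact_closedBall _ _))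
  rintro _ ⟨⟨⟨a, b, d⟩, hy⟩, hdev, rfl⟩
  have hy' : ‖a‖ ^ 2 + b ^ 2 = 1 := hy
  have ha : ‖a‖ ≤ 1 := by nlinarith [sq_nonneg b, norm_nonneg a]
  have hb : |b| ≤ 1 := abs_le_of_sq_le_sq (by nlinarith [sq_nonneg ‖a‖]) zero_le_one
  have hdist : infEDist p (hyperplane (a, b, d)) ≤ c :=
    ((le_biSup (f := fun x => infEDist x (hyperplane (a, b, d)))
      (⟨mem_ball_self hs, hp⟩ : p ∈ ball p s ∩ E)).trans le_self_add).trans hdev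
  obtain ⟨x, hx, hxy⟩ := (infEDist_hyperplane_le_iff p hy hc).1 hdist
  have hxM := hM x hx
  have hxv : ‖x.v‖ ≤ M := (norm_fst_le (x.v, x.t)).trans hxM
  have hxt : |x.t| ≤ M := (norm_snd_le (x.v, x.t)).trans hxM
  have hxy' : inner ℝ a x.v + b * x.t = d := hxy
  simp only [Set.mem_prod, mem_closedBall, dist_zero_right, Real.norm_eq_abs]
  refine ⟨ha, hb, ?_⟩
  rw [← hxy']
  have h1 : |inner ℝ a x.v| ≤ 1 * M :=
    (abs_real_inner_le_norm a x.v).trans (by gcongr)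
  have h2 : |b * x.t| ≤ 1 * M := by
    rw [abs_mul]
    gcongr
  linarith [abs_add_le (inner ℝ a x.v) (b * x.t)]

/-- Left continuity in the scale: nearly optimal hyperplanes for smaller balls form nested compact
sets, and a common element works for the full open ball. -/
lemma flatness_le_of_forall_lt {E : Set (Heisenberg k)} {p : Heisenberg k} (hp : p ∈ E) {s : ℝ}
    (hs : 0 < s) {c : ℝ≥0∞} (h : ∀ s' < s, flatness E p s' ≤ c) : flatness E p s ≤ c := by
  refine le_of_forall_gt_imp_ge_of_dense fun c' hc' => ?_
  rcases eq_or_ne c' ⊤ with rfl | htop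
  · exact le_top
  -- The shift by 2 keeps even the first radius positive, as compactness requires.
  let K : ℕ → Set (unitCoeffs k) := fun n =>
    {y | deviation E (hyperplane y.1) p (s - s / (n + 2)) ≤ c'}
  have hlt : ∀ n : ℕ, s - s / (n + 2) < s := fun n => by
    have : 0 < s / (n + 2) := by positivity
    linarith
  have hpos : ∀ n : ℕ, 0 < s - s / (n + 2) := fun n => by
    rw [sub_pos, div_lt_iff₀ (by positivity)]
    nlinarith [(Nat.cast_nonneg n : (0 : ℝ) ≤ n)]
  have hcomp : ∀ n, IsCompact (K n) := fun n => isCompact_deviation_le hp (hpos n) htop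
  have hne : ∀ n, (K n).Nonempty := fun n => by
    have := (h _ (hlt n)).trans_lt hc'
    simp only [flatness, iInf_lt_iff] at this
    obtain ⟨P, hP, hPc⟩ := this
    obtain ⟨y, hy, rfl⟩ := hP.exists_unitCoeffs
    exact ⟨⟨y, hy⟩, hPc.le⟩
  have hanti : ∀ n, K (n + 1) ⊆ K n := fun n y hy => by
    refine (deviation_mono E _ (ball_subset_ball ?_)).trans hy
    push_cast
    gcongr
    linarith
  obtain ⟨y, hy⟩ := IsCompact.nonempty_iInter_of_sequence_nonempty_isCompact_isClosed K hanti hne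
    (hcomp 0) fun n => (hcomp n).isClosed
  rw [Set.mem_iInter] at hy
  refine (iInf₂_le _ (isAffineHyperplane_hyperplane y.2)).trans ?_
  have hball : ∀ q ∈ ball p s, ∃ n₀ : ℕ, ∀ n ≥ n₀, q ∈ ball p (s - s / (n + 2)) := fun q hq => by
    have hl : Tendsto (fun n : ℕ => s - s / ((n : ℝ) + 2)) atTop (𝓝 (s - 0)) := by
      refine tendsto_const_nhds.sub (tendsto_const_nhds.div_atTop ?_)
      exact tendsto_atTop_add_const_right _ _ tendsto_natCast_atTop_atTop
    rw [sub_zero] at hl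
    exact eventually_atTop.1 (hl.eventually (lt_mem_nhds (mem_ball.1 hq)))
  -- A sum of two suprema can be bounded termwise only if both index sets are nonempty.
  rcases (ball p s ∩ hyperplane y.1).eq_empty_or_nonempty with he | he
  · have hdev : deviation E (hyperplane y.1) p s =
        ⨆ q ∈ ball p s ∩ E, infEDist q (hyperplane y.1) := by
      simp [deviation, he]
    rw [hdev]
    refine iSup₂_le fun q hq => ?_
    obtain ⟨n, hn⟩ := hball q hq.1
    exact ((le_biSup (f := fun x => infEDist x (hyperplane y.1))
      (⟨hn n le_rfl, hq.2⟩ : q ∈ ball p _ ∩ E)).trans le_self_add).trans (hy n)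
  · refine ENNReal.biSup_add_biSup_le' ⟨p, mem_ball_self hs, hp⟩ he fun q hq q' hq' => ?_
    obtain ⟨n, hn⟩ := hball q hq.1
    obtain ⟨n', hn'⟩ := hball q' hq'.1
    exact (add_le_add
      (le_biSup (f := fun x => infEDist x (hyperplane y.1))
        (⟨hn _ (le_max_left n n'), hq.2⟩ : q ∈ ball p _ ∩ E))
      (le_biSup (f := fun x => infEDist x E)
        (⟨hn' _ (le_max_right n n'), hq'.2⟩ : q' ∈ ball p _ ∩ hyperplane y.1))).trans
      (hy (max n n'))

/-- The set is relatively open in E × (0,∞): by left continuity non-flatness survives on a slightly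
smaller ball, and by monotonicity it passes to all balls containing that one. -/
lemma measurableSet_lt_bilateralBeta {E : Set (Heisenberg k)} (hE : IsClosed E) {ε : ℝ}
    (hε : 0 ≤ ε) :
    MeasurableSet {x : Heisenberg k × ℝ |
      x.1 ∈ E ∧ 0 < x.2 ∧ ENNReal.ofReal ε < bilateralBeta E x.1 x.2} := by
  let U : Set (Heisenberg k × ℝ) := ⋃ (p : Heisenberg k) (s : ℝ) (c : ℝ≥0∞)
    (_ : c < flatness E p s), {x | dist p x.1 < x.2 - s ∧ ENNReal.ofReal (ε * x.2) < c}
  have hU : IsOpen U := by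
    refine isOpen_iUnion fun p => isOpen_iUnion fun s => isOpen_iUnion fun c =>
      isOpen_iUnion fun _ => ?_
    have h1 : IsOpen {x : Heisenberg k × ℝ | dist p x.1 < x.2 - s} :=
      isOpen_lt (by fun_prop) (by fun_prop)
    have h2 : IsOpen {x : Heisenberg k × ℝ | ENNReal.ofReal (ε * x.2) < c} :=
      isOpen_lt (ENNReal.continuous_ofReal.comp (by fun_prop)) continuous_const
    exact h1.inter h2
  convert (hE.measurableSet.prod measurableSet_Ioi).inter hU.measurableSet (s₁ := E ×ˢ Set.Ioi 0)
    using 1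
  ext ⟨p, s⟩
  simp only [Set.mem_ofPred_eq, Set.mem_inter_iff, Set.mem_prod, Set.mem_Ioi, and_assoc,
    and_congr_right_iff, U, Set.mem_iUnion]
  intro hp hs
  rw [lt_bilateralBeta_iff hs hε]
  constructor
  · intro h
    obtain ⟨c, hc, hc'⟩ := exists_between h
    have : ∃ s' < s, c < flatness E p s' := by
      by_contra! hcon
      exact absurd (flatness_le_of_forall_lt hp hs hcon) (not_le.2 hc')
    obtain ⟨s', hs', hcs'⟩ := this
    exact ⟨p, s', c, hcs', by simpa using hs', hc⟩
  · rintro ⟨p', s', c, hc, hd, hcε⟩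
    exact hcε.trans (hc.trans_le (flatness_mono E hd.le))

/-! ### Covering arguments -/

section Covering

/-- The sum of the first scales is almost constant on a ball of the last radius. -/
lemma abs_sum_range_sub_le {X : Type*} [PseudoMetricSpace X] {h : ℕ → X → ℝ} {r : ℝ} (hr : 0 < r)
    (hlip : ∀ i x y, |h i x - h i y| ≤ dist x y / (r / 2 ^ i)) {m n : ℕ} (hmn : m ≤ n + 1)
    {x y : X} (hxy : dist x y ≤ r / 2 ^ n) :
    |∑ i ∈ Finset.range m, h i x - ∑ i ∈ Finset.range m, h i y| ≤ 2 := by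
  rw [← Finset.sum_sub_distrib]
  calc |∑ i ∈ Finset.range m, (h i x - h i y)|
      ≤ ∑ i ∈ Finset.range m, |h i x - h i y| := Finset.abs_sum_le_sum_abs _ _
    _ ≤ ∑ i ∈ Finset.range m, (2 : ℝ) ^ i / 2 ^ n := by
        refine Finset.sum_le_sum fun i _ => (hlip i x y).trans ?_
        calc dist x y / (r / 2 ^ i) ≤ (r / 2 ^ n) / (r / 2 ^ i) := by gcongr
          _ = 2 ^ i / 2 ^ n := by field_simp
    _ ≤ ∑ i ∈ Finset.range (n + 1), (2 : ℝ) ^ i / 2 ^ n :=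
        Finset.sum_le_sum_of_subset_of_nonneg (Finset.range_mono hmn)
          fun _ _ _ => by positivity
    _ ≤ 2 := by
        rw [← Finset.sum_div, geom_sum_eq (by norm_num), div_le_iff₀ (by positivity), pow_succ]
        norm_num
        linarith

/-- Bounded overlap, integrated. -/
lemma sum_measure_le_of_card_le {X ι : Type*} [MeasurableSpace X] (μ : Measure X) (s : Finset ι)
    {W : ι → Set X} (hW : ∀ i, MeasurableSet (W i)) {B : Set X} (hB : MeasurableSet B)
    (hWB : ∀ i, W i ⊆ B) {L : ℕ} (hL : ∀ x, ∀ t ⊆ s, (∀ i ∈ t, x ∈ W i) → t.card ≤ L) :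
    ∑ i ∈ s, μ (W i) ≤ L * μ B := by
  classical
  calc ∑ i ∈ s, μ (W i) = ∫⁻ x, ∑ i ∈ s, (W i).indicator (fun _ => 1) x ∂μ := by
        rw [lintegral_finsetSum _ fun i _ => measurable_const.indicator (hW i)]
        refine Finset.sum_congr rfl fun i _ => ?_
        rw [lintegral_indicator_const (hW i), one_mul]
    _ ≤ ∫⁻ x, B.indicator (fun _ => (L : ℝ≥0∞)) x ∂μ := by
        refine lintegral_mono fun x => ?_
        by_cases hx : x ∈ B
        · rw [Set.indicator_of_mem hx]
          simp only [Set.indicator_apply]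
          rw [Finset.sum_boole]
          exact_mod_cast hL x _ (Finset.filter_subset _ _) fun i hi => (Finset.mem_filter.1 hi).2
        · rw [Set.indicator_of_notMem hx]
          refine (Finset.sum_eq_zero fun i _ => ?_).le
          exact Set.indicator_of_notMem (fun h => hx (hWB i h)) _
    _ = L * μ B := lintegral_indicator_const hB _

/-! ### Vitali coverings and a John–Nirenberg type inequality -/

variable {X : Type*} [PseudoMetricSpace X] [MeasurableSpace X] [BorelSpace X]
  [TopologicalSpace.SeparableSpace X]

lemma measure_le_of_vitali (μ : Measure X) {Z W : Set X} (hW : MeasurableSet W) (ρ : X → ℝ)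
    {R : ℝ} (hρ : ∀ x ∈ Z, 0 < ρ x) (hR : ∀ x ∈ Z, ρ x ≤ R) {κ : ℝ≥0∞}
    (h : ∀ x ∈ Z, μ (Z ∩ closedBall x (5 * ρ x)) ≤ κ * μ (W ∩ closedBall x (ρ x))) :
    μ Z ≤ κ * μ W := by
  obtain ⟨u, huZ, hdisj, hcov⟩ := Vitali.exists_disjoint_subfamily_covering_enlargement_closedBall
    Z id ρ R hR 5 (by norm_num)
  simp only [id] at hdisj hcov
  have hcount : u.Countable := hdisj.countable_of_nonempty_interior fun x hx =>
    ⟨x, ball_subset_interior_closedBall (mem_ball_self (hρ x (huZ hx)))⟩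
  have hsub : Z ⊆ ⋃ x ∈ u, Z ∩ closedBall x (5 * ρ x) := fun x hx => by
    obtain ⟨b, hb, hxb⟩ := hcov x hx
    exact Set.mem_biUnion hb ⟨hx, hxb (mem_closedBall_self (hρ x hx).le)⟩
  calc μ Z ≤ ∑' x : u, μ (Z ∩ closedBall x.1 (5 * ρ x)) :=
        (measure_mono hsub).trans (measure_biUnion_le μ hcount _)
    _ ≤ ∑' x : u, κ * μ (W ∩ closedBall x.1 (ρ x)) :=
        ENNReal.tsum_le_tsum fun x => h x (huZ x.2)
    _ = κ * μ (⋃ x ∈ u, W ∩ closedBall x (ρ x)) := by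
        rw [ENNReal.tsum_mul_left, measure_biUnion hcount
          (hdisj.mono fun _ => Set.inter_subset_right)
          fun x _ => hW.inter measurableSet_closedBall]
    _ ≤ κ * μ W := by
        gcongr
        exact Set.iUnion₂_subset fun _ _ => Set.inter_subset_left

/-- At a point of the upper level set, stop at the first scale where the partial sum exceeds l + 2.
On the ball of that radius partial sums vary by at most 2, so a point with tail at most K has total
above l and at most (l + 4) + K: it lies in the difference of the level sets. -/
lemma measure_levelSet_le (μ : Measure X) {E : Set X} (hE : MeasurableSet E)
    {h : ℕ → X → ℝ} (hmeas : ∀ i, Measurable (h i)) (h0 : ∀ i x, 0 ≤ h i x) {r : ℝ} (hr : 0 < r)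
    (hlip : ∀ i x y, |h i x - h i y| ≤ dist x y / (r / 2 ^ i)) {N : ℕ} {K : ℝ} (hK : 0 ≤ K)
    {κ : ℝ≥0∞}
    (hgood : ∀ x ∈ E, ∀ n < N, μ (E ∩ closedBall x (5 * (r / 2 ^ n))) ≤
      κ * μ {y ∈ E ∩ closedBall x (r / 2 ^ n) | ∑ i ∈ Finset.Ico n N, h i y ≤ K})
    {l : ℝ} (hl : 0 ≤ l) :
    μ {x ∈ E | l + (K + 4) < ∑ i ∈ Finset.range N, h i x} ≤
      κ * μ ({x ∈ E | l < ∑ i ∈ Finset.range N, h i x} \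
        {x ∈ E | l + (K + 4) < ∑ i ∈ Finset.range N, h i x}) := by
  have hSmeas : Measurable fun x => ∑ i ∈ Finset.range N, h i x :=
    Finset.measurable_fun_sum _ fun i _ => hmeas i
  have hOm : ∀ c : ℝ, MeasurableSet {x ∈ E | c < ∑ i ∈ Finset.range N, h i x} := fun c =>
    hE.inter (measurableSet_lt measurable_const hSmeas)
  have hscale : ∀ x, ∃ n, x ∈ {x ∈ E | l + (K + 4) < ∑ i ∈ Finset.range N, h i x} →
      n < N ∧ ∑ i ∈ Finset.range n, h i x ≤ l + 2 ∧
        l + 2 < ∑ i ∈ Finset.range (n + 1), h i x := by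
    intro x
    by_cases hx : x ∈ {x ∈ E | l + (K + 4) < ∑ i ∈ Finset.range N, h i x}
    · have hex : ∃ n, l + 2 < ∑ i ∈ Finset.range n, h i x := ⟨N, by linarith [hx.2]⟩
      classical
      have hspec := Nat.find_spec hex
      have hne : Nat.find hex ≠ 0 := fun h0 => by
        rw [h0, Finset.sum_range_zero] at hspec
        linarith
      obtain ⟨n, hn⟩ := Nat.exists_eq_succ_of_ne_zero hne
      refine ⟨n, fun _ => ⟨?_, not_lt.1 (Nat.find_min hex (by omega)), by rwa [hn] at hspec⟩⟩
      have : Nat.find hex ≤ N := Nat.find_min' hex (by linarith [hx.2])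
      omega
    · exact ⟨0, fun h => absurd h hx⟩
  choose n hn using hscale
  refine measure_le_of_vitali μ ((hOm l).diff (hOm _)) (fun x => r / 2 ^ n x) (R := r)
    (fun x _ => by positivity) (fun x _ => div_le_self hr.le (one_le_pow₀ one_le_two))
    fun x hx => ?_
  obtain ⟨hnN, hle, hlt⟩ := hn x hx
  refine (measure_mono (Set.inter_subset_inter_left _ fun _ hy => hy.1)).trans
    ((hgood x hx.1 _ hnN).trans ?_)
  gcongr κ * ?_
  refine measure_mono ?_
  rintro y ⟨⟨hyE, hyb⟩, hyK⟩
  have hd : dist x y ≤ r / 2 ^ n x := by rwa [dist_comm]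
  have h1 := abs_le.1 (abs_sum_range_sub_le hr hlip le_rfl hd)
  have h2 := abs_le.1 (abs_sum_range_sub_le hr hlip (Nat.le_succ (n x)) hd)
  have h3 : ∑ i ∈ Finset.range (n x + 1), h i y ≤ ∑ i ∈ Finset.range N, h i y :=
    Finset.sum_le_sum_of_subset_of_nonneg (Finset.range_mono hnN) fun i _ _ => h0 i y
  have h4 := Finset.sum_range_add_sum_Ico (fun i => h i y) hnN.le
  exact ⟨⟨⟨hyE, by linarith⟩, fun hy => by linarith [hy.2]⟩, hyb⟩

/-- Layer-cake decomposition at the levels jT. Summing the level-set inequality against disjoint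
differences replaces geometric decay and needs no finiteness of measure. -/
lemma lintegral_sum_le_of_good_sets (μ : Measure X) {E : Set X} (hE : MeasurableSet E)
    {h : ℕ → X → ℝ} (hmeas : ∀ i, Measurable (h i)) (h0 : ∀ i x, 0 ≤ h i x)
    (h1 : ∀ i x, h i x ≤ 1) {r : ℝ} (hr : 0 < r)
    (hlip : ∀ i x y, |h i x - h i y| ≤ dist x y / (r / 2 ^ i)) {N : ℕ} {K : ℝ} (hK : 0 ≤ K)
    {κ : ℝ≥0∞}
    (hgood : ∀ x ∈ E, ∀ n < N, μ (E ∩ closedBall x (5 * (r / 2 ^ n))) ≤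
      κ * μ {y ∈ E ∩ closedBall x (r / 2 ^ n) | ∑ i ∈ Finset.Ico n N, h i y ≤ K}) :
    ∫⁻ x in E, ENNReal.ofReal (∑ i ∈ Finset.range N, h i x) ∂μ ≤
      ENNReal.ofReal (K + 4) * (1 + κ) * μ {x ∈ E | 0 < ∑ i ∈ Finset.range N, h i x} := by
  set S : X → ℝ := fun x => ∑ i ∈ Finset.range N, h i x with hS
  set T := K + 4 with hT
  have hTpos : 0 < T := by linarith
  have hSmeas : Measurable S := Finset.measurable_fun_sum _ fun i _ => hmeas i
  set Om : ℕ → Set X := fun j => {x ∈ E | j * T < S x} with hOm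
  have hOmeas : ∀ j, MeasurableSet (Om j) := fun j =>
    hE.inter (measurableSet_lt measurable_const hSmeas)
  have hanti : Antitone Om := fun i j hij x hx =>
    ⟨hx.1, lt_of_le_of_lt (by gcongr) hx.2⟩
  have hstep : ∀ j, μ (Om (j + 1)) ≤ κ * μ (Om j \ Om (j + 1)) := fun j => by
    have := measure_levelSet_le μ hE hmeas h0 hr hlip hK hgood (l := j * T) (by positivity)
    convert this using 3 <;> (try congr 1) <;> simp only [hOm, hS, ← hT] <;> push_cast <;>
      simp only [add_mul, one_mul]
  have hdisj : ∀ M, ∑ j ∈ Finset.range M, μ (Om j \ Om (j + 1)) ≤ μ (Om 0) := fun M => by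
    rw [← measure_biUnion_finset]
    · refine measure_mono (Set.iUnion₂_subset fun j _ => ?_)
      exact Set.sdiff_subset.trans (hanti (Nat.zero_le j))
    · intro i _ j _ hij
      rcases lt_or_gt_of_ne hij with hlt | hlt
      · exact Set.disjoint_left.2 fun x hx hx' => hx.2 (hanti hlt hx'.1)
      · exact Set.disjoint_left.2 fun x hx hx' => hx'.2 (hanti hlt hx.1)
    · exact fun j _ => (hOmeas j).diff (hOmeas _)
  have hpt : ∀ x ∈ E, ENNReal.ofReal (S x) ≤
      ∑ j ∈ Finset.range (N + 1), (Om j).indicator (fun _ => ENNReal.ofReal T) x := by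
    intro x hx
    classical
    have hSN : S x ≤ N := by
      calc S x ≤ ∑ i ∈ Finset.range N, (1 : ℝ) := Finset.sum_le_sum fun i _ => h1 i x
        _ = N := by simp
    have hT1 : 1 ≤ T := by linarith
    set m := ⌈S x / T⌉₊ with hm
    -- The sum has N terms bounded by 1 and T ≥ 1, so N + 1 levels suffice.
    have hmN : m ≤ N := by
      refine Nat.ceil_le.2 ((div_le_iff₀ hTpos).2 ?_)
      nlinarith [(Nat.cast_nonneg N : (0 : ℝ) ≤ N)]
    have hSm : S x ≤ m * T := (div_le_iff₀ hTpos).1 (Nat.le_ceil _)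
    calc ENNReal.ofReal (S x) ≤ ENNReal.ofReal (m * T) := ENNReal.ofReal_le_ofReal hSm
      _ = ∑ j ∈ Finset.range m, ENNReal.ofReal T := by
          rw [Finset.sum_const, Finset.card_range, nsmul_eq_mul, ENNReal.ofReal_mul (by positivity),
            ENNReal.ofReal_natCast]
      _ ≤ ∑ j ∈ Finset.range m, (Om j).indicator (fun _ => ENNReal.ofReal T) x := by
          refine Finset.sum_le_sum fun j hj => ?_
          have hj' : (j : ℝ) < S x / T := Nat.lt_ceil.1 (Finset.mem_range.1 hj)
          rw [Set.indicator_of_mem (show x ∈ Om j from ⟨hx, (lt_div_iff₀ hTpos).1 hj'⟩)]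
      _ ≤ _ := Finset.sum_le_sum_of_subset (Finset.range_mono (by omega))
  calc ∫⁻ x in E, ENNReal.ofReal (S x) ∂μ
      ≤ ∫⁻ x in E, ∑ j ∈ Finset.range (N + 1),
          (Om j).indicator (fun _ => ENNReal.ofReal T) x ∂μ := setLIntegral_mono' hE hpt
    _ ≤ ∫⁻ x, ∑ j ∈ Finset.range (N + 1),
          (Om j).indicator (fun _ => ENNReal.ofReal T) x ∂μ := setLIntegral_le_lintegral _ _
    _ = ENNReal.ofReal T * ∑ j ∈ Finset.range (N + 1), μ (Om j) := by
        rw [lintegral_finsetSum _ fun j _ => measurable_const.indicator (hOmeas j),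
          Finset.mul_sum]
        exact Finset.sum_congr rfl fun j _ => lintegral_indicator_const (hOmeas j) _
    _ ≤ ENNReal.ofReal T * ((1 + κ) * μ (Om 0)) := by
        gcongr
        rw [Finset.sum_range_succ', add_mul, one_mul, add_comm]
        gcongr
        calc ∑ j ∈ Finset.range N, μ (Om (j + 1))
            ≤ ∑ j ∈ Finset.range N, κ * μ (Om j \ Om (j + 1)) :=
              Finset.sum_le_sum fun j _ => hstep j
          _ ≤ κ * μ (Om 0) := by
              rw [← Finset.mul_sum]
              gcongr
              exact hdisj N
    _ = _ := by
        rw [mul_assoc]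
        simp [hOm, hS]

end Covering

/-! ### Comparison of a set with one of its big pieces -/

/-- If all three alternatives fail, a good hyperplane for E' on the doubled ball is good for E.
Doubling keeps the intermediate points of E' inside the ball. -/
lemma flatness_comparison {E E' : Set (Heisenberg k)} {y : Heisenberg k} {s ε : ℝ} (hs : 0 < s)
    (hε : 0 < ε) (hε1 : ε < 1) (h : ENNReal.ofReal (ε * s) < flatness E y s) :
    ENNReal.ofReal (2 * (ε / 40) * (2 * s)) < flatness E' y (2 * s) ∨
      (∃ z ∈ E ∩ ball y (2 * s), ENNReal.ofReal (ε / 40 * (2 * s)) < infEDist z E') ∨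
      ∃ z ∈ E' ∩ ball y (2 * s), ENNReal.ofReal (ε / 40 * (2 * s)) < infEDist z E := by
  by_contra! hcon
  obtain ⟨h1, h2, h3⟩ := hcon
  -- In this unit each one-sided distance comes out at most 5a, while εs = 20a.
  set a := ε * s / 20 with ha
  have hapos : 0 < a := by positivity
  have hεs : ε * s < s := by nlinarith
  rw [show 2 * (ε / 40) * (2 * s) = 2 * a by rw [ha]; ring] at h1
  rw [show ε / 40 * (2 * s) = a by rw [ha]; ring] at h2 h3
  rw [show ε * s = 20 * a by rw [ha]; ring] at h hεs
  have hlt : ∀ {b c : ℝ}, b < c → 0 < c → ENNReal.ofReal b < ENNReal.ofReal c :=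
    fun hbc hc => (ENNReal.ofReal_lt_ofReal_iff hc).2 hbc
  have hP := h1.trans_lt (hlt (show 2 * a < 3 * a by linarith) (by linarith))
  simp only [flatness, iInf_lt_iff] at hP
  obtain ⟨P, hP, hdev⟩ := hP
  have hclose : ∀ {z z' : Heisenberg k} {b : ℝ}, z ∈ ball y s → b ≤ s →
      edist z z' < ENNReal.ofReal b → z' ∈ ball y (2 * s) := by
    intro z z' b hz hb hzz'
    rw [edist_dist] at hzz'
    have h5 := (ENNReal.ofReal_lt_ofReal_iff_of_nonneg dist_nonneg).1 hzz'
    rw [mem_ball] at hz ⊢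
    linarith [dist_triangle_left z' y z]
  refine absurd h (not_lt.2 ?_)
  refine (iInf₂_le P hP).trans ?_
  have hA : ⨆ q ∈ ball y s ∩ E, infEDist q P ≤ ENNReal.ofReal (5 * a) := by
    refine iSup₂_le fun z hz => ?_
    have hz2 : z ∈ ball y (2 * s) := ball_subset_ball (by linarith) hz.1
    obtain ⟨z', hz', hzz'⟩ := infEDist_lt_iff.1 ((h2 z ⟨hz.2, hz2⟩).trans_lt
      (hlt (show a < 2 * a by linarith) (by linarith)))
    have hz'P : infEDist z' P ≤ ENNReal.ofReal (3 * a) :=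
      ((le_biSup (f := fun q => infEDist q P)
        (⟨hclose hz.1 (by linarith) hzz', hz'⟩ : z' ∈ ball y (2 * s) ∩ E')).trans
        le_self_add).trans hdev.le
    calc infEDist z P ≤ infEDist z' P + edist z z' := infEDist_le_infEDist_add_edist
      _ ≤ ENNReal.ofReal (3 * a) + ENNReal.ofReal (2 * a) := add_le_add hz'P hzz'.le
      _ = ENNReal.ofReal (5 * a) := by
          rw [← ENNReal.ofReal_add (by positivity) (by positivity)]
          congr 1
          ring
  have hB : ⨆ q ∈ ball y s ∩ P, infEDist q E ≤ ENNReal.ofReal (5 * a) := by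
    refine iSup₂_le fun z hz => ?_
    have hz2 : z ∈ ball y (2 * s) := ball_subset_ball (by linarith) hz.1
    have hzE' : infEDist z E' ≤ ENNReal.ofReal (3 * a) :=
      ((le_biSup (f := fun q => infEDist q E')
        (⟨hz2, hz.2⟩ : z ∈ ball y (2 * s) ∩ P)).trans le_add_self).trans hdev.le
    obtain ⟨z', hz', hzz'⟩ := infEDist_lt_iff.1 (hzE'.trans_lt
      (hlt (show 3 * a < 4 * a by linarith) (by linarith)))
    calc infEDist z E ≤ infEDist z' E + edist z z' := infEDist_le_infEDist_add_edist
      _ ≤ ENNReal.ofReal a + ENNReal.ofReal (4 * a) :=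
          add_le_add (h3 z' ⟨hz', hclose hz.1 (by linarith) hzz'⟩) hzz'.le
      _ = ENNReal.ofReal (5 * a) := by
          rw [← ENNReal.ofReal_add (by positivity) (by positivity)]
          congr 1
          ring
  calc deviation E P y s ≤ ENNReal.ofReal (5 * a) + ENNReal.ofReal (5 * a) := add_le_add hA hB
    _ = ENNReal.ofReal (10 * a) := by
        rw [← ENNReal.ofReal_add (by positivity) (by positivity)]
        congr 1
        ring
    _ ≤ ENNReal.ofReal (20 * a) := ENNReal.ofReal_le_ofReal (by linarith)

lemma IsAhlforsRegular.measure_inter_le {C : ℝ} {E : Set (Heisenberg k)}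
    (hE : IsAhlforsRegular C E) {p : Heisenberg k} (hp : p ∈ E) {r r' : ℝ} (hr : 0 < r')
    (hrr' : r < r') : surfaceMeasure k (E ∩ closedBall p r) ≤ ENNReal.ofReal (C * r' ^ (2 * k + 1)) :=
  (measure_mono (Set.inter_subset_inter_right _ (closedBall_subset_ball hrr'))).trans
    (hE.2 p hp r' hr).2

/-- The places and scales in `E ∩ E'` at which `E` is far from `E'` are sparse. -/
lemma sum_measure_far_le {C ε R : ℝ} (hC : 1 ≤ C) (hε : 0 < ε) (hε1 : ε < 1) (hR : 0 < R)
    {E E' F : Set (Heisenberg k)} (hE : IsAhlforsRegular C E) (hFE : F ⊆ E) (hFE' : F ⊆ E')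
    {q : Heisenberg k} (hq : q ∈ E) (hFq : F ⊆ ball q R) {L : ℕ} (hL : 4 / ε ≤ 2 ^ L) (N : ℕ) :
    ∑ i ∈ Finset.range N, surfaceMeasure k
        {y ∈ F | ∃ z ∈ E ∩ ball y (R / 2 ^ i), ENNReal.ofReal (ε * (R / 2 ^ i)) < infEDist z E'} ≤
      ENNReal.ofReal (C ^ 2 * (22 / ε) ^ (2 * k + 1) * (L * (C * (4 * R) ^ (2 * k + 1)))) := by
  -- Half the separation survives on the ball of radius ε(R/2^i)/2 around z; the upper bound holds
  -- because y lies in E'.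
  let W : ℕ → Set (Heisenberg k) := fun i => (E ∩ ball q (4 * R)) ∩
    {w | ENNReal.ofReal (ε * (R / 2 ^ i) / 2) < infEDist w E' ∧
      infEDist w E' ≤ ENNReal.ofReal (2 * (R / 2 ^ i))}
  have hBm : MeasurableSet (E ∩ ball q (4 * R)) := hE.1.measurableSet.inter measurableSet_ball
  have hWm : ∀ i, MeasurableSet (W i) := fun i => hBm.inter
    ((measurableSet_lt measurable_const continuous_infEDist.measurable).inter
      (measurableSet_le continuous_infEDist.measurable measurable_const))
  have hstep : ∀ i, surfaceMeasure k
      {y ∈ F | ∃ z ∈ E ∩ ball y (R / 2 ^ i), ENNReal.ofReal (ε * (R / 2 ^ i)) < infEDist z E'} ≤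
      ENNReal.ofReal (C ^ 2 * (22 / ε) ^ (2 * k + 1)) * surfaceMeasure k (W i) := by
    intro i
    set s := R / 2 ^ i with hs
    have hspos : 0 < s := by positivity
    have hsR : s ≤ R := div_le_self hR.le (one_le_pow₀ one_le_two)
    have hεs : ε * s < s := by nlinarith
    refine measure_le_of_vitali _ (hWm i) (fun _ => 2 * s) (R := 2 * s) (fun _ _ => by positivity)
      (fun _ _ => le_rfl) ?_
    rintro y ⟨hyF, z, ⟨hzE, hzy⟩, hz⟩
    calc surfaceMeasure k (_ ∩ closedBall y (5 * (2 * s)))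
        ≤ surfaceMeasure k (E ∩ closedBall y (5 * (2 * s))) :=
          measure_mono (Set.inter_subset_inter_left _ fun x hx => hFE hx.1)
      _ ≤ ENNReal.ofReal (C * (11 * s) ^ (2 * k + 1)) :=
          hE.measure_inter_le (hFE hyF) (by positivity) (by linarith)
      _ = ENNReal.ofReal (C ^ 2 * (22 / ε) ^ (2 * k + 1)) *
            ENNReal.ofReal (C⁻¹ * (ε * s / 2) ^ (2 * k + 1)) := by
          rw [← ENNReal.ofReal_mul (by positivity)]
          congr 1
          have h11 : 11 * s = 22 / ε * (ε * s / 2) := by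
            field_simp
            norm_num
          rw [h11, mul_pow]
          field_simp
      _ ≤ ENNReal.ofReal (C ^ 2 * (22 / ε) ^ (2 * k + 1)) *
            surfaceMeasure k (W i ∩ closedBall y (2 * s)) := by
          gcongr
          refine ((hE.2 z hzE (ε * s / 2) (by positivity)).1).trans (measure_mono ?_)
          rintro w ⟨hwE, hwz⟩
          rw [mem_ball] at hwz hzy
          have hwy : dist w y < 2 * s := by linarith [dist_triangle w z y]
          have hyq : dist y q < R := hFq hyF
          refine ⟨⟨⟨hwE, ?_⟩, ?_, ?_⟩, hwy.le⟩
          · rw [mem_ball]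
            linarith [dist_triangle w y q]
          · by_contra! hcon
            refine absurd hz (not_lt.2 ?_)
            calc infEDist z E' ≤ infEDist w E' + edist z w := infEDist_le_infEDist_add_edist
              _ ≤ ENNReal.ofReal (ε * s / 2) + ENNReal.ofReal (ε * s / 2) := by
                  refine add_le_add hcon ?_
                  rw [edist_dist, dist_comm]
                  exact ENNReal.ofReal_le_ofReal hwz.le
              _ = ENNReal.ofReal (ε * s) := by
                  rw [← ENNReal.ofReal_add (by positivity) (by positivity), add_halves]
          · refine (infEDist_le_edist_of_mem (hFE' hyF)).trans ?_
            rw [edist_dist]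
            exact ENNReal.ofReal_le_ofReal hwy.le
  -- The distance from x to E' fixes the scale up to the factor 4/ε ≤ 2^L.
  have hcard : ∀ x, ∀ t ⊆ Finset.range N, (∀ i ∈ t, x ∈ W i) → t.card ≤ L := by
    intro x t _ ht
    rcases t.eq_empty_or_nonempty with rfl | hne
    · simp
    have hsub : t ⊆ Finset.Ico (t.min' hne) (t.min' hne + L) := fun i hi => by
      rw [Finset.mem_Ico]
      refine ⟨t.min'_le i hi, ?_⟩
      have h1 := (ht _ (t.min'_mem hne)).2.1
      have h2 := (ht i hi).2.2
      have h3 := (ENNReal.ofReal_lt_ofReal_iff (by positivity)).1 (h1.trans_le h2)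
      set m := t.min' hne
      have h4 : (2 : ℝ) ^ i < 2 ^ (m + L) := by
        have h5 : (2 : ℝ) ^ i < 4 / ε * 2 ^ m := by
          rw [div_mul_eq_mul_div, lt_div_iff₀ hε]
          have h6 : ε * (R / 2 ^ m) / 2 * (2 * 2 ^ m * 2 ^ i / R) <
              2 * (R / 2 ^ i) * (2 * 2 ^ m * 2 ^ i / R) := by
            gcongr
          have h7 : ε * (R / 2 ^ m) / 2 * (2 * 2 ^ m * 2 ^ i / R) = 2 ^ i * ε := by field_simp
          have h8 : 2 * (R / 2 ^ i) * (2 * 2 ^ m * 2 ^ i / R) = 4 * 2 ^ m := by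
            field_simp
            norm_num
          rwa [h7, h8] at h6
        calc (2 : ℝ) ^ i < 4 / ε * 2 ^ m := h5
          _ ≤ 2 ^ L * 2 ^ m := by gcongr
          _ = 2 ^ (m + L) := by ring
      exact (pow_lt_pow_iff_right₀ one_lt_two).1 h4
    simpa using Finset.card_le_card hsub
  calc _ ≤ ∑ i ∈ Finset.range N,
        ENNReal.ofReal (C ^ 2 * (22 / ε) ^ (2 * k + 1)) * surfaceMeasure k (W i) :=
        Finset.sum_le_sum fun i _ => hstep i
    _ ≤ ENNReal.ofReal (C ^ 2 * (22 / ε) ^ (2 * k + 1)) *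
          (L * ENNReal.ofReal (C * (4 * R) ^ (2 * k + 1))) := by
        rw [← Finset.mul_sum]
        gcongr
        refine (sum_measure_le_of_card_le _ _ hWm hBm (fun i => Set.inter_subset_left)
          hcard).trans ?_
        gcongr
        exact (hE.2 q hq (4 * R) (by positivity)).2
    _ = _ := by
        rw [← ENNReal.ofReal_natCast L, ← ENNReal.ofReal_mul (by positivity),
          ← ENNReal.ofReal_mul (by positivity)]

lemma sum_measure_le_of_isCarleson {γ ε R : ℝ} (hε : 0 < ε) (hR : 0 < R)
    {E F : Set (Heisenberg k)}
    (hE : IsCarleson E γ {x | x.1 ∈ E ∧ 0 < x.2 ∧ ENNReal.ofReal ε < bilateralBeta E x.1 x.2})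
    (hFE : F ⊆ E) {q : Heisenberg k} (hq : q ∈ E) (hFq : F ⊆ ball q (2 * R)) (N : ℕ) :
    ∑ i ∈ Finset.range N, surfaceMeasure k
        {y ∈ F | ENNReal.ofReal (2 * ε * (R / 2 ^ i)) < flatness E y (R / 2 ^ i)} ≤
      ENNReal.ofReal (2 * (γ * (2 * R) ^ (2 * k + 1))) := by
  obtain ⟨-, hAm, hA⟩ := hE
  set A := {x : Heisenberg k × ℝ |
    x.1 ∈ E ∧ 0 < x.2 ∧ ENNReal.ofReal ε < bilateralBeta E x.1 x.2} with hAdef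
  set f : ℝ → ℝ≥0∞ := fun s => (∫⁻ q in E ∩ ball q (2 * R),
    A.indicator (fun _ => (1 : ℝ≥0∞)) (q, s) ∂surfaceMeasure k) / ENNReal.ofReal s with hf
  have hstep : ∀ i : ℕ, surfaceMeasure k
      {y ∈ F | ENNReal.ofReal (2 * ε * (R / 2 ^ i)) < flatness E y (R / 2 ^ i)} ≤
      2 * ∫⁻ s in Set.Ioo (R / 2 ^ i) (2 * (R / 2 ^ i)), f s := by
    intro i
    set a := R / 2 ^ i with ha
    have hapos : 0 < a := by positivity
    set G := {y ∈ F | ENNReal.ofReal (2 * ε * a) < flatness E y a} with hG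
    -- Non-flatness 2ε at scale a forces non-flatness ε at every scale in (a, 2a); the intervals for
    -- different i are disjoint.
    have hfs : ∀ s ∈ Set.Ioo a (2 * a), surfaceMeasure k G / ENNReal.ofReal (2 * a) ≤ f s := by
      intro s hs
      have hspos : 0 < s := hapos.trans hs.1
      refine ENNReal.div_le_div ?_ (ENNReal.ofReal_le_ofReal hs.2.le)
      have hAs : MeasurableSet ((fun x : Heisenberg k => (x, s)) ⁻¹' A) :=
        measurable_prodMk_right hAm
      have hind : ∀ x : Heisenberg k, A.indicator (fun _ => (1 : ℝ≥0∞)) (x, s) =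
          ((fun x : Heisenberg k => (x, s)) ⁻¹' A).indicator (fun _ => 1) x := fun x => rfl
      simp only [hind]
      rw [lintegral_indicator_const hAs, one_mul, Measure.restrict_apply hAs]
      refine measure_mono fun y hy => ⟨⟨hFE hy.1, hspos, ?_⟩, hFE hy.1, hFq hy.1⟩
      rw [lt_bilateralBeta_iff hspos hε.le]
      refine lt_of_le_of_lt (ENNReal.ofReal_le_ofReal ?_)
        (hy.2.trans_le (flatness_mono E (by simpa using hs.1.le)))
      nlinarith [hs.2]
    have h2 : surfaceMeasure k G / ENNReal.ofReal (2 * a) * ENNReal.ofReal a ≤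
        ∫⁻ s in Set.Ioo a (2 * a), f s := by
      calc _ = ∫⁻ s in Set.Ioo a (2 * a), surfaceMeasure k G / ENNReal.ofReal (2 * a) := by
            rw [setLIntegral_const, Real.volume_Ioo]
            congr 2
            ring
        _ ≤ _ := setLIntegral_mono' measurableSet_Ioo hfs
    calc surfaceMeasure k G
        = 2 * (surfaceMeasure k G / ENNReal.ofReal (2 * a) * ENNReal.ofReal a) := by
          rw [mul_comm 2, mul_assoc, mul_comm _ (2 : ℝ≥0∞),
            show (2 : ℝ≥0∞) * ENNReal.ofReal a = ENNReal.ofReal (2 * a) by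
              rw [ENNReal.ofReal_mul zero_le_two, ENNReal.ofReal_ofNat],
            ENNReal.div_mul_cancel (by simpa using hapos) ENNReal.ofReal_ne_top]
      _ ≤ _ := by gcongr
  have hdisj : ∀ {i j : ℕ}, i < j → Disjoint (Set.Ioo (R / 2 ^ i) (2 * (R / 2 ^ i)))
      (Set.Ioo (R / 2 ^ j) (2 * (R / 2 ^ j))) := by
    intro i j hij
    refine Set.disjoint_left.2 fun s hs hs' => ?_
    have : 2 * (R / 2 ^ j) ≤ R / 2 ^ i := by
      obtain ⟨d, rfl⟩ := Nat.exists_eq_add_of_lt hij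
      calc 2 * (R / 2 ^ (i + d + 1)) = R / 2 ^ i / 2 ^ d := by
            field_simp
            ring
        _ ≤ R / 2 ^ i := div_le_self (by positivity) (one_le_pow₀ one_le_two)
    linarith [hs.1, hs'.2]
  calc _ ≤ ∑ i ∈ Finset.range N, 2 * ∫⁻ s in Set.Ioo (R / 2 ^ i) (2 * (R / 2 ^ i)), f s :=
        Finset.sum_le_sum fun i _ => hstep i
    _ = 2 * ∫⁻ s in ⋃ i ∈ Finset.range N, Set.Ioo (R / 2 ^ i) (2 * (R / 2 ^ i)), f s := by
        rw [← Finset.mul_sum, lintegral_biUnion_finset _ fun _ _ => measurableSet_Ioo]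
        intro i _ j _ hij
        rcases lt_or_gt_of_ne hij with h | h
        · exact hdisj h
        · exact (hdisj h).symm
    _ ≤ 2 * ∫⁻ s in Set.Ioo 0 (2 * R), f s := by
        gcongr
        refine Set.iUnion₂_subset fun i _ => Set.Ioo_subset_Ioo (by positivity) ?_
        gcongr
        exact div_le_self hR.le (one_le_pow₀ one_le_two)
    _ ≤ 2 * ENNReal.ofReal (γ * (2 * R) ^ (2 * k + 1)) := by
        gcongr
        exact hA q hq (2 * R) (by positivity)
    _ = _ := by rw [ENNReal.ofReal_mul zero_le_two, ENNReal.ofReal_ofNat]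

/-- The constant bounding the total size of the bad places and scales in a big piece. -/
def pieceConst (k : ℕ) (C C₁ γ ε : ℝ) (L : ℕ) : ℝ :=
  2 * (γ * 8 ^ (2 * k + 1)) +
    (C ^ 2 * (22 / ε) ^ (2 * k + 1) * (L * (C * 16 ^ (2 * k + 1))) +
      C₁ ^ 2 * (22 / ε) ^ (2 * k + 1) * (L * (C₁ * 16 ^ (2 * k + 1))))

lemma sum_measure_piece_le {C C₁ γ ε ρ : ℝ} (hC : 1 ≤ C) (hC₁ : 1 ≤ C₁) (hγ : 0 < γ) (hε : 0 < ε)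
    (hε1 : ε < 1) (hρ : 0 < ρ) {E E' : Set (Heisenberg k)} (hE : IsAhlforsRegular C E)
    (hE' : IsAhlforsRegular C₁ E')
    (hcarl : IsCarleson E' γ
      {x | x.1 ∈ E' ∧ 0 < x.2 ∧ ENNReal.ofReal (ε / 40) < bilateralBeta E' x.1 x.2})
    {L : ℕ} (hL : 4 / (ε / 40) ≤ 2 ^ L) (x : Heisenberg k) (N : ℕ) :
    ∑ i ∈ Finset.range N, surfaceMeasure k {y ∈ E ∩ E' ∩ ball x ρ |
        ENNReal.ofReal (ε * (2 * (ρ / 2 ^ i))) < flatness E y (2 * (ρ / 2 ^ i))} ≤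
      ENNReal.ofReal (pieceConst k C C₁ γ (ε / 40) L * ρ ^ (2 * k + 1)) := by
  set F := E ∩ E' ∩ ball x ρ with hF
  rcases F.eq_empty_or_nonempty with he | ⟨q, hq⟩
  · simp [he]
  -- The estimates need a centre in both E and E', hence q instead of x. Radius 4ρ makes the dyadic
  -- scales match those doubled by the comparison.
  have hFball : F ⊆ ball q (4 * ρ) := fun y hy => by
    have h1 : dist y x < ρ := hy.2
    have h2 : dist q x < ρ := hq.2
    rw [mem_ball]
    linarith [dist_triangle_right y q x]
  have hFE : F ⊆ E := fun y hy => hy.1.1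
  have hFE' : F ⊆ E' := fun y hy => hy.1.2
  have h1 := sum_measure_le_of_isCarleson (R := 4 * ρ) (by positivity) (by positivity) hcarl hFE'
    (hFE' hq) (hFball.trans (ball_subset_ball (by linarith))) N
  have h2 := sum_measure_far_le (R := 4 * ρ) hC (show 0 < ε / 40 by positivity) (by linarith)
    (by positivity) hE hFE hFE' (hFE hq) hFball hL N
  have h3 := sum_measure_far_le (R := 4 * ρ) hC₁ (show 0 < ε / 40 by positivity) (by linarith)
    (by positivity) hE' hFE' hFE (hFE' hq) hFball hL N
  have hscale : ∀ i : ℕ, 4 * ρ / 2 ^ i = 2 * (2 * (ρ / 2 ^ i)) := fun i => by ring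
  simp only [hscale] at h1 h2 h3
  refine le_trans ?_ ((add_le_add h1 (add_le_add h2 h3)).trans_eq ?_)
  swap
  · rw [← ENNReal.ofReal_add (by positivity) (by positivity),
      ← ENNReal.ofReal_add (by positivity) (by positivity)]
    congr 1
    simp only [pieceConst, mul_pow]
    rw [show (16 : ℝ) = 4 * 4 by norm_num, show (8 : ℝ) = 2 * 4 by norm_num, mul_pow, mul_pow]
    ring
  rw [← Finset.sum_add_distrib, ← Finset.sum_add_distrib]
  refine Finset.sum_le_sum fun i _ => (measure_mono ?_).trans ((measure_union_le _ _).trans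
    (add_le_add_right (measure_union_le _ _) _))
  rintro y ⟨hyF, hy⟩
  rcases flatness_comparison (E' := E') (by positivity) hε hε1 hy with h | h | h
  · exact Or.inl ⟨hyF, h⟩
  · exact Or.inr (Or.inl ⟨hyF, h⟩)
  · exact Or.inr (Or.inr ⟨hyF, h⟩)

/-! ### Proof of the theorem -/

open Classical in
/-- A Lipschitz function equal to `1` on `D` and to `0` at distance at least `s` from `D`. -/
def bump {X : Type*} [PseudoMetricSpace X] (D : Set X) (s : ℝ) (x : X) : ℝ :=
  -- `infDist` to the empty set is 0, which would otherwise give the value 1 everywhere.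
  if D.Nonempty then max 0 (1 - infDist x D / s) else 0

section Bump

variable {X : Type*} [PseudoMetricSpace X] {D : Set X} {s : ℝ}

lemma bump_nonneg (x : X) : 0 ≤ bump D s x := by
  unfold bump
  split_ifs
  · exact le_max_left _ _
  · exact le_rfl

lemma bump_le_one (hs : 0 < s) (x : X) : bump D s x ≤ 1 := by
  unfold bump
  split_ifs
  · have : 0 ≤ infDist x D / s := div_nonneg infDist_nonneg hs.le
    exact max_le zero_le_one (by linarith)
  · exact zero_le_one

lemma bump_eq_one {x : X} (hx : x ∈ D) : bump D s x = 1 := by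
  have hne : D.Nonempty := ⟨x, hx⟩
  simp [bump, hne, infDist_zero_of_mem hx]

lemma exists_dist_lt_of_bump_pos (hs : 0 < s) {x : X} (hx : 0 < bump D s x) :
    ∃ y ∈ D, dist x y < s := by
  unfold bump at hx
  split_ifs at hx with hne
  · refine (infDist_lt_iff hne).1 ?_
    rcases lt_max_iff.1 hx with h | h
    · exact absurd h (lt_irrefl _)
    · rw [sub_pos, div_lt_one hs] at h
      exact h
  · exact absurd hx (lt_irrefl _)

lemma abs_bump_sub_le (hs : 0 < s) (x y : X) :
    |bump D s x - bump D s y| ≤ dist x y / s := by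
  unfold bump
  split_ifs
  · rw [max_comm 0, max_comm 0]
    refine (abs_max_sub_max_le_abs _ _ _).trans ?_
    rw [show 1 - infDist x D / s - (1 - infDist y D / s) = (infDist y D - infDist x D) / s by ring,
      abs_div, abs_of_pos hs, abs_sub_comm]
    gcongr
    exact abs_sub_le_iff.2 ⟨by linarith [infDist_le_infDist_add_dist (s := D) (x := x) (y := y)],
      by linarith [infDist_le_infDist_add_dist (s := D) (x := y) (y := x), dist_comm x y]⟩
  · simpa using div_nonneg dist_nonneg hs.le

lemma continuous_bump : Continuous (bump D s) := by
  unfold bump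
  split_ifs
  · exact continuous_const.max (continuous_const.sub ((continuous_infDist_pt D).div_const s))
  · exact continuous_const

end Bump

/-- Chebyshev's inequality: if the bad places and scales in a big piece are summable, then a large
part of the ball is good. -/
lemma le_measure_good {E F B : Set (Heisenberg k)} (hFE : F ⊆ E)
    (hFB : F ⊆ B) {h : ℕ → Heisenberg k → ℝ} (hmeas : ∀ i, Measurable (h i))
    (h0 : ∀ i x, 0 ≤ h i x) (h1 : ∀ i x, h i x ≤ 1) {θ K₀ V : ℝ} (hθ : 0 < θ) (hK₀ : 0 < K₀)
    (hV : 0 ≤ V) (hbig : ENNReal.ofReal (θ * V) ≤ surfaceMeasure k F) (s : Finset ℕ)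
    (hsum : ∑ i ∈ s, surfaceMeasure k {y ∈ F | 0 < h i y} ≤ ENNReal.ofReal (K₀ * V)) :
    ENNReal.ofReal (θ / 2 * V) ≤
      surfaceMeasure k {y ∈ E ∩ B | ∑ i ∈ s, h i y ≤ 2 * K₀ / θ} := by
  set μ := surfaceMeasure k
  set K := 2 * K₀ / θ with hK
  have hKpos : 0 < K := by positivity
  have hSm : Measurable fun y => ∑ i ∈ s, h i y := Finset.measurable_fun_sum _ fun i _ => hmeas i
  have hintegral_le : ∫⁻ y in F, ENNReal.ofReal (∑ i ∈ s, h i y) ∂μ ≤ ENNReal.ofReal (K₀ * V) := by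
    calc ∫⁻ y in F, ENNReal.ofReal (∑ i ∈ s, h i y) ∂μ
        = ∑ i ∈ s, ∫⁻ y in F, ENNReal.ofReal (h i y) ∂μ := by
          rw [← lintegral_finsetSum _ fun i _ => (hmeas i).ennreal_ofReal]
          refine lintegral_congr fun y => ?_
          exact ENNReal.ofReal_sum_of_nonneg fun i _ => h0 i y
      _ ≤ ∑ i ∈ s, μ {y ∈ F | 0 < h i y} := by
          refine Finset.sum_le_sum fun i _ => ?_
          have hpos : MeasurableSet {y | 0 < h i y} :=
            measurableSet_lt measurable_const (hmeas i)
          calc ∫⁻ y in F, ENNReal.ofReal (h i y) ∂μ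
              ≤ ∫⁻ y in F, {y | 0 < h i y}.indicator (fun _ => 1) y ∂μ := by
                refine lintegral_mono fun y => ?_
                by_cases hy : 0 < h i y
                · rw [Set.indicator_of_mem (show y ∈ {y | 0 < h i y} from hy)]
                  exact ENNReal.ofReal_le_one.2 (h1 i y)
                · rw [ENNReal.ofReal_of_nonpos (not_lt.1 hy)]
                  exact zero_le
            _ = μ {y ∈ F | 0 < h i y} := by
                rw [lintegral_indicator_const hpos, one_mul, Measure.restrict_apply hpos,
                  Set.inter_comm]
                rfl
      _ ≤ _ := hsum
  -- K = 2K₀/θ is chosen so that the bad part uses at most half of the guaranteed measure θV.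
  have hbad : μ {y ∈ F | K < ∑ i ∈ s, h i y} ≤ ENNReal.ofReal (θ / 2 * V) := by
    have hcheb := mul_meas_ge_le_lintegral (μ := μ.restrict F) hSm.ennreal_ofReal
      (ENNReal.ofReal K)
    have hset : MeasurableSet {y | ENNReal.ofReal K ≤ ENNReal.ofReal (∑ i ∈ s, h i y)} :=
      measurableSet_le measurable_const hSm.ennreal_ofReal
    rw [Measure.restrict_apply hset] at hcheb
    have hle : ENNReal.ofReal K * μ {y ∈ F | K < ∑ i ∈ s, h i y} ≤
        ENNReal.ofReal K * ENNReal.ofReal (θ / 2 * V) := by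
      calc _ ≤ ENNReal.ofReal (K₀ * V) := by
            refine le_trans ?_ (hcheb.trans hintegral_le)
            gcongr
            exact fun y hy => ⟨ENNReal.ofReal_le_ofReal hy.2.le, hy.1⟩
        _ = _ := by
            rw [← ENNReal.ofReal_mul hKpos.le]
            congr 1
            rw [hK]
            field_simp
    exact (ENNReal.mul_le_mul_iff_right (by simpa using hKpos) ENNReal.ofReal_ne_top).1 hle
  have hsplit : ENNReal.ofReal (θ / 2 * V) + ENNReal.ofReal (θ / 2 * V) ≤
      μ {y ∈ E ∩ B | ∑ i ∈ s, h i y ≤ K} + ENNReal.ofReal (θ / 2 * V) := by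
    calc _ = ENNReal.ofReal (θ * V) := by
          rw [← ENNReal.ofReal_add (by positivity) (by positivity)]
          congr 1
          ring
      _ ≤ μ F := hbig
      _ ≤ μ ({y ∈ E ∩ B | ∑ i ∈ s, h i y ≤ K} ∪ {y ∈ F | K < ∑ i ∈ s, h i y}) := by
          refine measure_mono fun y hy => ?_
          rcases le_or_gt (∑ i ∈ s, h i y) K with hle | hlt
          · exact Or.inl ⟨⟨hFE hy, hFB hy⟩, hle⟩
          · exact Or.inr ⟨hy, hlt⟩
      _ ≤ _ := (measure_union_le _ _).trans (add_le_add_right hbad _)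
  exact (ENNReal.add_le_add_iff_right ENNReal.ofReal_ne_top).1 hsplit

/-- The Carleson integral is bounded by a sum over dyadic scales. -/
lemma lintegral_le_tsum_measure {E : Set (Heisenberg k)} (hE : IsClosed E) {ε : ℝ} (hε : 0 < ε)
    (p : Heisenberg k) {r : ℝ} (hr : 0 < r) :
    ∫⁻ s in Set.Ioo 0 r, (∫⁻ q in E ∩ ball p r,
        {x : Heisenberg k × ℝ | x.1 ∈ E ∧ 0 < x.2 ∧
          ENNReal.ofReal ε < bilateralBeta E x.1 x.2}.indicator (fun _ => (1 : ℝ≥0∞)) (q, s)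
        ∂surfaceMeasure k) / ENNReal.ofReal s ≤
      ∑' i : ℕ, surfaceMeasure k
        {x ∈ E ∩ ball p r | ENNReal.ofReal (ε / 2 * (r / 2 ^ i)) < flatness E x (r / 2 ^ i)} := by
  set A := {x : Heisenberg k × ℝ | x.1 ∈ E ∧ 0 < x.2 ∧
    ENNReal.ofReal ε < bilateralBeta E x.1 x.2} with hA
  have hcover : Set.Ioo 0 r ⊆ ⋃ i : ℕ, Set.Ioc (r / 2 ^ (i + 1)) (r / 2 ^ i) := by
    intro s hs
    obtain ⟨i, hi1, hi2⟩ := exists_nat_pow_near (x := r / s) (y := 2)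
      ((one_le_div hs.1).2 hs.2.le) one_lt_two
    rw [le_div_iff₀ hs.1] at hi1
    rw [div_lt_iff₀ hs.1] at hi2
    refine Set.mem_iUnion.2 ⟨i, ?_, ?_⟩
    · rw [div_lt_iff₀ (by positivity)]
      linarith
    · rw [le_div_iff₀ (by positivity)]
      linarith
  refine (lintegral_mono_set hcover).trans ((lintegral_iUnion_le _ _).trans
    (ENNReal.tsum_le_tsum fun i => ?_))
  set a := r / 2 ^ (i + 1) with ha
  have hapos : 0 < a := by positivity
  have h2a : r / 2 ^ i = 2 * a := by
    rw [ha, pow_succ]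
    field_simp
  rw [h2a]
  set G := {x ∈ E ∩ ball p r | ENNReal.ofReal (ε / 2 * (2 * a)) < flatness E x (2 * a)} with hG
  have hbound : ∀ s ∈ Set.Ioc a (2 * a), (∫⁻ q in E ∩ ball p r,
      A.indicator (fun _ => (1 : ℝ≥0∞)) (q, s) ∂surfaceMeasure k) / ENNReal.ofReal s ≤
      surfaceMeasure k G / ENNReal.ofReal a := by
    intro s hs
    have hspos : 0 < s := hapos.trans hs.1
    refine ENNReal.div_le_div ?_ (ENNReal.ofReal_le_ofReal hs.1.le)
    -- A pointwise bound by the indicator of G suffices, without measurability of G.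
    have hsub : ∀ q, (E ∩ ball p r).indicator
        (fun q => A.indicator (fun _ => (1 : ℝ≥0∞)) (q, s)) q ≤ G.indicator (fun _ => 1) q := by
      intro q
      by_cases hq : q ∈ E ∩ ball p r ∧ (q, s) ∈ A
      · have hqG : q ∈ G := by
          refine ⟨hq.1, ?_⟩
          have hlt := (lt_bilateralBeta_iff hspos hε.le).1 hq.2.2.2
          refine lt_of_le_of_lt (ENNReal.ofReal_le_ofReal ?_)
            (hlt.trans_le (flatness_mono E (by simpa using hs.2)))
          nlinarith [hs.1]
        rw [Set.indicator_of_mem hqG, Set.indicator_of_mem hq.1, Set.indicator_of_mem hq.2]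
      · rw [not_and_or] at hq
        rcases hq with hq | hq
        · rw [Set.indicator_of_notMem hq]
          exact zero_le
        · refine (Set.indicator_le_self _ _ q).trans ?_
          rw [Set.indicator_of_notMem hq]
          exact zero_le
    calc _ = ∫⁻ q, (E ∩ ball p r).indicator
          (fun q => A.indicator (fun _ => (1 : ℝ≥0∞)) (q, s)) q ∂surfaceMeasure k :=
          (lintegral_indicator (hE.measurableSet.inter measurableSet_ball) _).symm
      _ ≤ ∫⁻ q, G.indicator (fun _ => 1) q ∂surfaceMeasure k := lintegral_mono hsub
      _ ≤ surfaceMeasure k G := by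
          refine (lintegral_indicator_const_le _ _).trans_eq (one_mul _)
  calc _ ≤ ∫⁻ _ in Set.Ioc a (2 * a), surfaceMeasure k G / ENNReal.ofReal a :=
        setLIntegral_mono' measurableSet_Ioc hbound
    _ = surfaceMeasure k G := by
        rw [setLIntegral_const, Real.volume_Ioc, show 2 * a - a = a by ring,
          ENNReal.div_mul_cancel (by simpa using hapos) ENNReal.ofReal_ne_top]

/-- The Carleson constant of a set with big pieces whose bad places and scales are controlled by
`K₀`. -/
def carlesonConst (k : ℕ) (C θ K₀ : ℝ) : ℝ :=
  (2 * K₀ / θ + 4) * (1 + 2 * C * 6 ^ (2 * k + 1) / θ) * (C * 2 ^ (2 * k + 1))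

/-- Chebyshev on the pieces supplies the good sets for the John–Nirenberg step; all bounds are
uniform in the number N of scales. -/
lemma isCarleson_of_bigPieces {C θ K₀ ε : ℝ} (hC : 1 ≤ C) (hθ : 0 < θ) (hK₀ : 0 < K₀) (hε : 0 < ε)
    {E : Set (Heisenberg k)} (hE : IsAhlforsRegular C E)
    (hpiece : ∀ x ∈ E, ∀ ρ : ℝ, 0 < ρ → ∃ F, F ⊆ E ∩ ball x ρ ∧
      ENNReal.ofReal (θ * ρ ^ (2 * k + 1)) ≤ surfaceMeasure k F ∧
      ∀ N, ∑ i ∈ Finset.range N, surfaceMeasure k {y ∈ F |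
        ENNReal.ofReal (ε / 4 * (2 * (ρ / 2 ^ i))) < flatness E y (2 * (ρ / 2 ^ i))} ≤
          ENNReal.ofReal (K₀ * ρ ^ (2 * k + 1))) :
    IsCarleson E (carlesonConst k C θ K₀)
      {x | x.1 ∈ E ∧ 0 < x.2 ∧ ENNReal.ofReal ε < bilateralBeta E x.1 x.2} := by
  refine ⟨fun x hx => ⟨hx.1, hx.2.1⟩, measurableSet_lt_bilateralBeta hE.1 hε.le,
    fun p hp r hr => (lintegral_le_tsum_measure hE.1 hε p hr).trans
      (ENNReal.tsum_le_of_sum_range_le fun N => ?_)⟩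
  set μ := surfaceMeasure k
  set D : ℕ → Set (Heisenberg k) := fun i =>
    {x ∈ E ∩ ball p r | ENNReal.ofReal (ε / 2 * (r / 2 ^ i)) < flatness E x (r / 2 ^ i)} with hD
  set h : ℕ → Heisenberg k → ℝ := fun i => bump (D i) (r / 2 ^ i) with hh
  have hspos : ∀ i : ℕ, 0 < r / 2 ^ i := fun i => by positivity
  have hsr : ∀ i : ℕ, r / 2 ^ i ≤ r := fun i => div_le_self hr.le (one_le_pow₀ one_le_two)
  have hmeas : ∀ i, Measurable (h i) := fun i => continuous_bump.measurable
  have h0 : ∀ i x, 0 ≤ h i x := fun i x => bump_nonneg x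
  have h1 : ∀ i x, h i x ≤ 1 := fun i x => bump_le_one (hspos i) x
  -- The bump enlarges the bad set by one radius, which costs a doubled scale and hence half of ε/2.
  have hflat : ∀ i y, 0 < h i y →
      ENNReal.ofReal (ε / 4 * (2 * (r / 2 ^ i))) < flatness E y (2 * (r / 2 ^ i)) := by
    intro i y hy
    obtain ⟨z, hz, hyz⟩ := exists_dist_lt_of_bump_pos (hspos i) hy
    rw [show ε / 4 * (2 * (r / 2 ^ i)) = ε / 2 * (r / 2 ^ i) by ring]
    refine hz.2.trans_le (flatness_mono E ?_)
    rw [dist_comm]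
    linarith
  have hgood : ∀ x ∈ E, ∀ n < N, μ (E ∩ closedBall x (5 * (r / 2 ^ n))) ≤
      ENNReal.ofReal (2 * C * 6 ^ (2 * k + 1) / θ) * μ {y ∈ E ∩ closedBall x (r / 2 ^ n) |
        ∑ i ∈ Finset.Ico n N, h i y ≤ 2 * K₀ / θ} := by
    intro x hx n _
    set ρ := r / 2 ^ n with hρ
    obtain ⟨F, hFs, hFbig, hFsum⟩ := hpiece x hx ρ (hspos n)
    have hsum : ∑ i ∈ Finset.Ico n N, μ {y ∈ F | 0 < h i y} ≤
        ENNReal.ofReal (K₀ * ρ ^ (2 * k + 1)) := by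
      rw [Finset.sum_Ico_eq_sum_range]
      refine le_trans (Finset.sum_le_sum fun i _ => measure_mono ?_) (hFsum (N - n))
      rintro y ⟨hyF, hy⟩
      have := hflat _ y hy
      rw [show r / 2 ^ (n + i) = ρ / 2 ^ i by rw [hρ, pow_add, div_div]] at this
      exact ⟨hyF, this⟩
    have hbig := le_measure_good (fun y hy => (hFs hy).1)
      (fun y hy => ball_subset_closedBall (hFs hy).2) hmeas h0 h1 hθ hK₀
      (pow_nonneg (hspos n).le _) hFbig _ hsum
    calc μ (E ∩ closedBall x (5 * ρ)) ≤ ENNReal.ofReal (C * (6 * ρ) ^ (2 * k + 1)) :=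
          hE.measure_inter_le hx (by linarith [hspos n]) (by linarith [hspos n])
      _ = ENNReal.ofReal (2 * C * 6 ^ (2 * k + 1) / θ) *
            ENNReal.ofReal (θ / 2 * ρ ^ (2 * k + 1)) := by
          rw [← ENNReal.ofReal_mul (by positivity), mul_pow]
          congr 1
          field_simp
      _ ≤ _ := by gcongr
  have hmain := lintegral_sum_le_of_good_sets μ hE.1.measurableSet hmeas h0 h1 hr
    (fun i x y => abs_bump_sub_le (hspos i) x y) (by positivity) hgood
  have hsupp : {x ∈ E | 0 < ∑ i ∈ Finset.range N, h i x} ⊆ E ∩ ball p (2 * r) := by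
    rintro x ⟨hxE, hx⟩
    refine ⟨hxE, ?_⟩
    obtain ⟨i, _, hi⟩ := Finset.exists_lt_of_sum_lt (f := fun _ => (0 : ℝ))
      (by simpa using hx)
    obtain ⟨z, hz, hxz⟩ := exists_dist_lt_of_bump_pos (hspos i) hi
    have hzp : dist z p < r := hz.1.2
    rw [mem_ball]
    linarith [dist_triangle x z p, hsr i]
  calc ∑ i ∈ Finset.range N, μ (D i)
      ≤ ∑ i ∈ Finset.range N, ∫⁻ x in E, ENNReal.ofReal (h i x) ∂μ := by
        refine Finset.sum_le_sum fun i _ => ?_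
        have hm : Measurable fun x => ENNReal.ofReal (h i x) := (hmeas i).ennreal_ofReal
        have := mul_meas_ge_le_lintegral (μ := μ.restrict E) hm 1
        rw [one_mul, Measure.restrict_apply (measurableSet_le measurable_const hm)] at this
        refine le_trans (measure_mono ?_) this
        intro x hx
        refine ⟨?_, hx.1.1⟩
        simp [hh, bump_eq_one hx]
    _ = ∫⁻ x in E, ENNReal.ofReal (∑ i ∈ Finset.range N, h i x) ∂μ := by
        rw [← lintegral_finsetSum _ fun i _ => (hmeas i).ennreal_ofReal]
        refine lintegral_congr fun y => ?_
        exact (ENNReal.ofReal_sum_of_nonneg fun i _ => h0 i y).symm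
    _ ≤ _ := hmain
    _ ≤ ENNReal.ofReal (2 * K₀ / θ + 4) * (1 + ENNReal.ofReal (2 * C * 6 ^ (2 * k + 1) / θ)) *
          ENNReal.ofReal (C * (2 * r) ^ (2 * k + 1)) := by
        gcongr
        exact (measure_mono hsupp).trans (hE.2 p hp (2 * r) (by positivity)).2
    _ = _ := by
        rw [← ENNReal.ofReal_one, ← ENNReal.ofReal_add zero_le_one (by positivity),
          ← ENNReal.ofReal_mul (by positivity), ← ENNReal.ofReal_mul (by positivity)]
        congr 1
        rw [carlesonConst, mul_pow]
        ring

end Heisenberg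

end

theorem theorem4p4 (k : ℕ) (hk : 1 ≤ k) (C θ C₁ : ℝ) (hC : 1 ≤ C) (hθ : 0 < θ) (hC₁ : 1 ≤ C₁)
    (γ₁ : Set.Ioo (0 : ℝ) 1 → Set.Ioi (0 : ℝ)) :
    ∃ γ : Set.Ioo (0 : ℝ) 1 → Set.Ioi (0 : ℝ),
      ∀ E : Set (Heisenberg k), Heisenberg.IsAhlforsRegular C E →
        (∀ p ∈ E, ∀ r : ℝ, 0 < r → ∃ E' ∈ Heisenberg.BWGL k C₁ γ₁,
          ENNReal.ofReal (θ * r ^ (2 * k + 1)) ≤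
            Heisenberg.surfaceMeasure k (E ∩ E' ∩ Metric.ball p r)) →
        E ∈ Heisenberg.BWGL k C γ := by
  have key : ∀ ε : Set.Ioo (0 : ℝ) 1, ∃ γ : Set.Ioi (0 : ℝ),
      ∀ E : Set (Heisenberg k), Heisenberg.IsAhlforsRegular C E →
        (∀ p ∈ E, ∀ r : ℝ, 0 < r → ∃ E' ∈ Heisenberg.BWGL k C₁ γ₁,
          ENNReal.ofReal (θ * r ^ (2 * k + 1)) ≤
            Heisenberg.surfaceMeasure k (E ∩ E' ∩ Metric.ball p r)) →
        Heisenberg.IsCarleson E γ {x | x.1 ∈ E ∧ 0 < x.2 ∧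
          ENNReal.ofReal (ε : ℝ) < Heisenberg.bilateralBeta E x.1 x.2} := by
    rintro ⟨ε, hε, hε1⟩
    obtain ⟨L, hL⟩ := pow_unbounded_of_one_lt (4 / (ε / 4 / 40)) (one_lt_two (α := ℝ))
    -- The 4 comes from dyadic discretization and the bumps, the 40 from the comparison of E with
    -- E'.
    let ε' : Set.Ioo (0 : ℝ) 1 := ⟨ε / 4 / 40, by positivity, by linarith⟩
    have hγpos : (0 : ℝ) < γ₁ ε' := (γ₁ ε').2
    have hKpos : 0 < Heisenberg.pieceConst k C C₁ (γ₁ ε') (ε / 4 / 40) L := by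
      unfold Heisenberg.pieceConst
      positivity
    refine ⟨⟨Heisenberg.carlesonConst k C θ
      (Heisenberg.pieceConst k C C₁ (γ₁ ε') (ε / 4 / 40) L), ?_⟩, fun E hE hbig => ?_⟩
    · simp only [Set.mem_Ioi, Heisenberg.carlesonConst]
      positivity
    refine Heisenberg.isCarleson_of_bigPieces hC hθ hKpos hε hE fun x hx ρ hρ => ?_
    obtain ⟨E', hE', hm⟩ := hbig x hx ρ hρ
    exact ⟨E ∩ E' ∩ ball x ρ,
      fun y hy => ⟨hy.1.1, hy.2⟩, hm, fun N => Heisenberg.sum_measure_piece_le hC hC₁ hγpos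
        (by linarith) (by linarith) hρ hE hE'.1 (hE'.2 ε') hL.le x N⟩
  choose γ hγ using key
  exact ⟨γ, fun E hE hbig => ⟨hE, fun ε => hγ ε E hE hbig⟩⟩
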